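/- Let $\mathcal H$ and $\mathcal K$ be separable real Hilbert spaces, let $0<\beta<2$, and let $(X,Y)$ be a pair of random variables with values in $\mathcal H\times\mathcal K$. Let $(X_1,Y_1),\dots,(X_4,Y_4)$ be independent copies of $(X,Y)$, and put $$\hat X_\beta=\|X_1-X_2\|^\beta-\|X_2-X_3\|^\beta+\|X_3-X_4\|^\beta-\|X_4-X_1\|^\beta,\qquad \tilde X_\beta=\mathbb E(\hat X_\beta\mid X_1,X_2),$$ and similarly $\hat Y_\beta$ and $\tilde Y_\beta=\mathbb E(\hat Y_\beta\mid Y_1,Y_2)$. Consider the following four definitions of the distance covariance $\mathrm{DC}_\beta(X,Y)$. 1. If $\mathbb E\|X\|^{2\beta}<\infty$ and $\mathbb E\|Y\|^{2\beta}<\infty$: $$\mathrm{DC}_\beta(X,Y)=\mathbb E\big[\|X_1-X_2\|^\beta\|Y_1-Y_2\|^\beta\big]+\mathbb E\|X_1-X_2\|^\beta\,\mathbb E\|Y_1-Y_2\|^\beta-2\,\mathbb E\big[\|X_1-X_2\|^\beta\|Y_1-Y_3\|^\beta\big].$$ 2. If $\mathbb E\|X\|^{\beta}<\infty$ and $\mathbb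 E\|Y\|^{\beta}<\infty$: $\ \mathrm{DC}_\beta(X,Y)=\tfrac14\mathbb E[\hat X_\beta\hat Y_\beta]$. 3. If $\mathbb E\|X\|^{\beta}<\infty$ and $\mathbb E\|Y\|^{\beta}<\infty$: $\ \mathrm{DC}_\beta(X,Y)=\mathbb E[\tilde X_\beta\tilde Y_\beta]$. 4. Without any moment condition: fix orthonormal bases $(e_i)_{i=1}^{\dim\mathcal H}$ of $\mathcal H$ and $(f_j)_{j=1}^{\dim\mathcal K}$ of $\mathcal K$, and i.i.d. $N(0,1)$ random variables $\xi_i$ and $\eta_j$, independent of each other and of $(X,Y)$. Put $\xi\cdot x=\sum_{i}\langle x,e_i\rangle\xi_i$ and $\eta\cdot y=\sum_j\langle y,f_j\rangle\eta_j$, where the sums are limits of partial sums in the given order, which exist almost surely. Then $$\mathrm{DC}_\beta(X,Y)=c_\beta^2\int_0^\infty\!\!\int_0^\infty \mathbb E\Big|\mathbb E\big(e^{\mathrm i r\,\xi\cdot X+\mathrm i s\,\eta\cdot Y}\mid \xi,\eta\big)-\mathbb E\big(e^{\mathrm i r\,\xi\cdot X}\mid\xi\big)\,\mathbb E\big(e^{\mathrm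 i s\,\eta\cdot Y}\mid\eta\big)\Big|^2\frac{dr\,ds}{r^{\beta+1}s^{\beta+1}}\in[0,\infty],$$ where $c_\beta=2^{1+\beta/2}/(-\Gamma(-\beta/2))>0$. Under the stated moment conditions, the expectations in definitions 1, 2 and 3 are finite. For each of the four definitions (for the first three, under the moment condition stated there), $\mathrm{DC}_\beta(X,Y)=0$ if and only if $X$ and $Y$ are independent. -/

import Mathlib

open MeasureTheory ProbabilityTheory Filter Topology
open scoped ENNReal

noncomputable section

namespace DistCov

/-- `(Xs i, Ys i)`, for the four indices `i = 0, 1, 2, 3`, are independent copies, defined on the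
probability space `(Ω', P')`, of the pair `(X, Y)`, which is defined on `(Ω, P)`. -/
structure IsIndepCopies {H K Ω Ω' : Type*} [MeasurableSpace H] [MeasurableSpace K]
    [MeasurableSpace Ω] [MeasurableSpace Ω'] (P : Measure Ω) (X : Ω → H) (Y : Ω → K)
    (P' : Measure Ω') (Xs : Fin 4 → Ω' → H) (Ys : Fin 4 → Ω' → K) : Prop where
  measurable_left : ∀ i, Measurable (Xs i)
  measurable_right : ∀ i, Measurable (Ys i)
  indep : iIndepFun (fun i ω => (Xs i ω, Ys i ω)) P'
  identDistrib : ∀ i, IdentDistrib (fun ω => (Xs i ω, Ys i ω)) (fun ω => (X ω, Y ω)) P' P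

/-! ### The definitions of distance covariance by means of independent copies -/

/-- The distance power `ω ↦ d(Z i, Z j) ^ β`. -/
def distPow {E Ω : Type*} [Dist E] (β : ℝ) (Z : Fin 4 → Ω → E) (i j : Fin 4) (ω : Ω) : ℝ :=
  dist (Z i ω) (Z j ω) ^ β

/-- `E[d(X₁,X₂)^β d(Y₁,Y₂)^β] + E[d(X₁,X₂)^β] E[d(Y₁,Y₂)^β] - 2 E[d(X₁,X₂)^β d(Y₁,Y₃)^β]`. -/
def dcovOne {H K Ω : Type*} [Dist H] [Dist K] [MeasurableSpace Ω] (β : ℝ) (P : Measure Ω)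
    (Xs : Fin 4 → Ω → H) (Ys : Fin 4 → Ω → K) : ℝ :=
  (∫ ω, distPow β Xs 0 1 ω * distPow β Ys 0 1 ω ∂P)
    + (∫ ω, distPow β Xs 0 1 ω ∂P) * (∫ ω, distPow β Ys 0 1 ω ∂P)
    - 2 * ∫ ω, distPow β Xs 0 1 ω * distPow β Ys 0 2 ω ∂P

/-- All the expectations that occur in `dcovOne` are finite. -/
def DcovOneFinite {H K Ω : Type*} [Dist H] [Dist K] [MeasurableSpace Ω] (β : ℝ) (P : Measure Ω)
    (Xs : Fin 4 → Ω → H) (Ys : Fin 4 → Ω → K) : Prop :=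
  Integrable (fun ω => distPow β Xs 0 1 ω * distPow β Ys 0 1 ω) P ∧
  Integrable (distPow β Xs 0 1) P ∧
  Integrable (distPow β Ys 0 1) P ∧
  Integrable (fun ω => distPow β Xs 0 1 ω * distPow β Ys 0 2 ω) P

/-- `d(Z₁,Z₂)^β - d(Z₂,Z₃)^β + d(Z₃,Z₄)^β - d(Z₄,Z₁)^β`. -/
def hatVar {E Ω : Type*} [Dist E] (β : ℝ) (Z : Fin 4 → Ω → E) (ω : Ω) : ℝ :=
  distPow β Z 0 1 ω - distPow β Z 1 2 ω + distPow β Z 2 3 ω - distPow β Z 3 0 ω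

/-- `(1/4) E[X̂ Ŷ]`. -/
def dcovTwo {H K Ω : Type*} [Dist H] [Dist K] [MeasurableSpace Ω] (β : ℝ) (P : Measure Ω)
    (Xs : Fin 4 → Ω → H) (Ys : Fin 4 → Ω → K) : ℝ :=
  (1 / 4) * ∫ ω, hatVar β Xs ω * hatVar β Ys ω ∂P

/-- The expectation that occurs in `dcovTwo` is finite. -/
def DcovTwoFinite {H K Ω : Type*} [Dist H] [Dist K] [MeasurableSpace Ω] (β : ℝ) (P : Measure Ω)
    (Xs : Fin 4 → Ω → H) (Ys : Fin 4 → Ω → K) : Prop :=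
  Integrable (fun ω => hatVar β Xs ω * hatVar β Ys ω) P

/-- The conditional expectation of `hatVar β Z` given the first two copies `(Z₁, Z₂)`. -/
def tildeVar {E Ω : Type*} [Dist E] [MeasurableSpace E] [MeasurableSpace Ω] (β : ℝ)
    (P : Measure Ω) (Z : Fin 4 → Ω → E) : Ω → ℝ :=
  P[hatVar β Z | MeasurableSpace.comap (fun ω => (Z 0 ω, Z 1 ω)) inferInstance]

/-- `E[X̃ Ỹ]`. -/
def dcovThree {H K Ω : Type*} [Dist H] [Dist K] [MeasurableSpace H] [MeasurableSpace K]
    [MeasurableSpace Ω] (β : ℝ) (P : Measure Ω)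
    (Xs : Fin 4 → Ω → H) (Ys : Fin 4 → Ω → K) : ℝ :=
  ∫ ω, tildeVar β P Xs ω * tildeVar β P Ys ω ∂P

/-- The conditional expectations that define `X̃` and `Ỹ` are those of integrable variables, and
the expectation that occurs in `dcovThree` is finite. -/
def DcovThreeFinite {H K Ω : Type*} [Dist H] [Dist K] [MeasurableSpace H] [MeasurableSpace K]
    [MeasurableSpace Ω] (β : ℝ) (P : Measure Ω)
    (Xs : Fin 4 → Ω → H) (Ys : Fin 4 → Ω → K) : Prop :=
  Integrable (hatVar β Xs) P ∧ Integrable (hatVar β Ys) P ∧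
  Integrable (fun ω => tildeVar β P Xs ω * tildeVar β P Ys ω) P

/-! ### The definition by means of characteristic random variables -/

/-- The indices `0, 1, …` (fewer than `N` of them, if `N` is finite) of an orthonormal basis in a
separable Hilbert space of finite or countably infinite dimension `N`. -/
abbrev Idx (N : ℕ∞) : Type := {i : ℕ // (i : ℕ∞) < N}

/-- The dot product `∑ i, ⟪x, e i⟫ t i`, where the sum over the indices is taken in their natural
order, as the limit of the partial sums (for Gaussian `t` in infinite dimension, the series converges
almost surely, but in general not absolutely). -/
def dot {N : ℕ∞} {H : Type*} [NormedAddCommGroup H] [InnerProductSpace ℝ H]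
    (e : HilbertBasis (Idx N) ℝ H) (t : Idx N → ℝ) (x : H) : ℝ :=
  limUnder atTop (fun n : ℕ => ∑ i ∈ Finset.range n,
    if h : (i : ℕ∞) < N then inner ℝ x (e ⟨i, h⟩) * t ⟨i, h⟩ else 0)

/-- All `ξ i` and `η j` are standard normal random variables that are independent of each other
and of `(X, Y)`. -/
structure IsGaussianAux {ι κ H K Ω : Type*} [MeasurableSpace H] [MeasurableSpace K]
    [MeasurableSpace Ω] (P : Measure Ω) (X : Ω → H) (Y : Ω → K)
    (ξ : Ω → ι → ℝ) (η : Ω → κ → ℝ) : Prop where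
  measurable_left : ∀ i, Measurable (fun ω => ξ ω i)
  measurable_right : ∀ j, Measurable (fun ω => η ω j)
  law_left : ∀ i, P.map (fun ω => ξ ω i) = gaussianReal 0 1
  law_right : ∀ j, P.map (fun ω => η ω j) = gaussianReal 0 1
  indep : iIndepFun (fun (k : ι ⊕ κ) ω => Sum.elim (ξ ω) (η ω) k) P
  indep_pair : IndepFun (fun ω => (ξ ω, η ω)) (fun ω => (X ω, Y ω)) P

/-- The characteristic random variable `Φ_X(ξ) = E(exp(i ξ·X) | ξ)`. -/
def charVar {N : ℕ∞} {H Ω : Type*} [NormedAddCommGroup H] [InnerProductSpace ℝ H]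
    [MeasurableSpace Ω] (P : Measure Ω) (e : HilbertBasis (Idx N) ℝ H)
    (ξ : Ω → Idx N → ℝ) (X : Ω → H) : Ω → ℂ :=
  P[fun ω => Complex.exp (Complex.I * (dot e (ξ ω) (X ω) : ℂ)) |
    MeasurableSpace.comap ξ inferInstance]

/-- The characteristic random variable `Φ_(X,Y)(ξ,η) = E(exp(i ξ·X + i η·Y) | ξ, η)`. -/
def jointCharVar {N M : ℕ∞} {H K Ω : Type*} [NormedAddCommGroup H] [InnerProductSpace ℝ H]
    [NormedAddCommGroup K] [InnerProductSpace ℝ K]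
    [MeasurableSpace Ω] (P : Measure Ω) (e : HilbertBasis (Idx N) ℝ H)
    (f : HilbertBasis (Idx M) ℝ K) (ξ : Ω → Idx N → ℝ) (η : Ω → Idx M → ℝ)
    (X : Ω → H) (Y : Ω → K) : Ω → ℂ :=
  P[fun ω => Complex.exp
      (Complex.I * (dot e (ξ ω) (X ω) : ℂ) + Complex.I * (dot f (η ω) (Y ω) : ℂ)) |
    MeasurableSpace.comap (fun ω => (ξ ω, η ω)) inferInstance]

/-- The normalizing constant `2^(1+β/2) / (-Γ(-β/2))`. -/
def gaussConst (β : ℝ) : ℝ := (2 : ℝ) ^ (1 + β / 2) / (-Real.Gamma (-β / 2))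

/-- `c_β² ∫₀^∞ ∫₀^∞ E|Φ_(rX,sY)(ξ,η) - Φ_(rX)(ξ) Φ_(sY)(η)|² dr ds / (r^(β+1) s^(β+1))`,
an element of `[0, ∞]`. -/
def dcovGauss {N M : ℕ∞} {H K Ω : Type*} [NormedAddCommGroup H] [InnerProductSpace ℝ H]
    [NormedAddCommGroup K] [InnerProductSpace ℝ K]
    [MeasurableSpace Ω] (β : ℝ) (P : Measure Ω) (e : HilbertBasis (Idx N) ℝ H)
    (f : HilbertBasis (Idx M) ℝ K) (ξ : Ω → Idx N → ℝ) (η : Ω → Idx M → ℝ)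
    (X : Ω → H) (Y : Ω → K) : ℝ≥0∞ :=
  ENNReal.ofReal (gaussConst β ^ 2) *
    ∫⁻ s in Set.Ioi (0 : ℝ), ∫⁻ r in Set.Ioi (0 : ℝ),
      (∫⁻ ω, ‖jointCharVar P e f ξ η (fun ω' => r • X ω') (fun ω' => s • Y ω') ω
          - charVar P e ξ (fun ω' => r • X ω') ω * charVar P f η (fun ω' => s • Y ω') ω‖ₑ ^ 2 ∂P)
        * ENNReal.ofReal (1 / (r ^ (β + 1) * s ^ (β + 1)))

end DistCov

end

noncomputable section

namespace DistCov

set_option linter.unusedSectionVars false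

/-! All four quantities are reduced to one: the mean `hsic a b μ` of the product of two alternating
sums over a quadrilateral of four independent pairs with law `μ`, the law of `(X, Y)`. If `a` and
`b` are bounded kernels with countably many features, `hsic a b μ` is four times the sum of the
squared covariances of the features of `a` with those of `b` (`IsFeatureMap.hasSum_hsic`). It is
therefore nonnegative, and it vanishes exactly when all these covariances do. For Gaussian kernels
of nonzero scales this forces `μ` to be the product of its marginals, because integrals against
Gaussian kernels determine a measure (`ext_of_integral_gaussKernel`,
`eq_prod_of_hsic_scaledKernel_eq_zero`).

For `0 < β < 2` the power `dist x y ^ β` is, up to a positive constant, the integral of `1 -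
scaledKernel r x y` against `r ^ (-β-1) dr`. The constant `1` cancels in alternating sums, so `hsic`
of the distance powers is a mixture, over pairs of scales, of nonnegative Gaussian `hsic`
(`integral_hsic_scaledKernel`), and it vanishes only under independence. Fubini's theorem is
justified by a four-point Cauchy–Schwarz inequality (`integral_abs_quad_scaledKernel_le`), whose
bound splits into square roots of distance powers; this is why moments of order `β` suffice.

It remains to identify the definitions. The second is `hsic / 4`. Expanding the product of
alternating sums gives the same for the first (`integral_quad_mul_quad`). For the third, the
conditional expectations are doubly centred distances, which have the same alternating sums but zero
marginal means. For the fourth, the inner expectation is the Gaussian `hsic` divided by `4`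
(`lintegral_charVar`); all integrands are nonnegative, so no moments are needed. -/

/-! ### Kernels with countably many features -/

/-- The functions `ψ i` are the coordinates of a feature map of the kernel `k`. -/
structure IsFeatureMap {ι α : Type*} [MeasurableSpace α] (ψ : ι → α → ℝ) (k : α → α → ℝ) :
    Prop where
  measurable : ∀ i, Measurable (ψ i)
  hasSum : ∀ x y, HasSum (fun i => ψ i x * ψ i y) (k x y)

namespace IsFeatureMap

variable {ι κ α γ : Type*} [MeasurableSpace α] [MeasurableSpace γ]
  {ψ : ι → α → ℝ} {φ : κ → α → ℝ} {k l : α → α → ℝ}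

lemma hasSum_sq (h : IsFeatureMap ψ k) (x : α) : HasSum (fun i => ψ i x ^ 2) (k x x) := by
  simpa only [sq] using h.hasSum x x

lemma comp (h : IsFeatureMap ψ k) {g : γ → α} (hg : Measurable g) :
    IsFeatureMap (fun i x => ψ i (g x)) (fun x y => k (g x) (g y)) :=
  ⟨fun i => (h.measurable i).comp hg, fun x y => h.hasSum (g x) (g y)⟩

lemma mul (h : IsFeatureMap ψ k) (h' : IsFeatureMap φ l) :
    IsFeatureMap (fun (i : ι × κ) x => ψ i.1 x * φ i.2 x) (fun x y => k x y * l x y) := by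
  refine ⟨fun i => (h.measurable _).mul (h'.measurable _), fun x y => ?_⟩
  have := (h.hasSum x y).mul (h'.hasSum x y)
    (summable_mul_of_summable_norm (h.hasSum x y).summable.norm (h'.hasSum x y).summable.norm)
  simpa only [mul_mul_mul_comm (ψ _ x) (ψ _ y)] using this

/-- The feature map of the second difference of a kernel, as a kernel on pairs. -/
lemma sub_sub (h : IsFeatureMap ψ k) :
    IsFeatureMap (fun i (p : α × α) => ψ i p.1 - ψ i p.2)
      (fun p q => k p.1 q.1 - k q.1 p.2 + k p.2 q.2 - k q.2 p.1) := by
  refine ⟨fun i => ((h.measurable i).comp measurable_fst).sub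
    ((h.measurable i).comp measurable_snd), fun p q => ?_⟩
  have e : (fun i => (ψ i p.1 - ψ i p.2) * (ψ i q.1 - ψ i q.2)) = fun i =>
      ψ i p.1 * ψ i q.1 - ψ i q.1 * ψ i p.2 + ψ i p.2 * ψ i q.2 - ψ i q.2 * ψ i p.1 := by
    funext i; ring
  rw [e]
  exact (((h.hasSum p.1 q.1).sub (h.hasSum q.1 p.2)).add (h.hasSum p.2 q.2)).sub
    (h.hasSum q.2 p.1)

/-- The exponential of a kernel all of whose powers have feature maps. -/
lemma exp {ι : ℕ → Type*} {ψ : ∀ n, ι n → α → ℝ} (h : ∀ n, IsFeatureMap (ψ n)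
    (fun x y => k x y ^ n)) :
    IsFeatureMap (fun (i : Σ n, ι n) x => ψ i.1 i.2 x / √(i.1.factorial))
      (fun x y => Real.exp (k x y)) := by
  have key (x y : α) (n : ℕ) : HasSum
      (fun j => ψ n j x / √(n.factorial) * (ψ n j y / √(n.factorial)))
      (k x y ^ n / n.factorial) := by
    simp only [div_mul_div_comm, Real.mul_self_sqrt (Nat.cast_nonneg n.factorial)]
    exact ((h n).hasSum x y).div_const (n.factorial : ℝ)
  have hexp (x y : α) : HasSum (fun n : ℕ => k x y ^ n / n.factorial) (Real.exp (k x y)) := by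
    rw [Real.exp_eq_exp_ℝ]
    exact NormedSpace.expSeries_div_hasSum_exp (k x y)
  have hsq (x : α) : Summable fun i : Σ n, ι n => (ψ i.1 i.2 x / √(i.1.factorial)) ^ 2 := by
    refine (summable_sigma_of_nonneg fun _ => sq_nonneg _).2 ⟨fun n => ?_, ?_⟩
    · simpa only [sq] using (key x x n).summable
    · simp only [sq, (key x x _).tsum_eq]
      exact (hexp x x).summable
  refine ⟨fun i => ((h i.1).measurable i.2).div_const _, fun x y => ?_⟩
  refine (hexp x y).sigma_of_hasSum (key x y) ?_
  -- The double series converges absolutely: each product of two features is bounded by the sum of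
  -- their squares, which are summable on the diagonal.
  refine Summable.of_norm_bounded ((hsq x).add (hsq y)) fun i => ?_
  rw [Real.norm_eq_abs, abs_mul]
  nlinarith [sq_abs (ψ i.1 i.2 x / √(i.1.factorial)), sq_abs (ψ i.1 i.2 y / √(i.1.factorial)),
    sq_nonneg (|ψ i.1 i.2 x / √(i.1.factorial)| - |ψ i.1 i.2 y / √(i.1.factorial)|),
    abs_nonneg (ψ i.1 i.2 x / √(i.1.factorial)), abs_nonneg (ψ i.1 i.2 y / √(i.1.factorial)),
    sq_nonneg (|ψ i.1 i.2 x / √(i.1.factorial)|), sq_nonneg (|ψ i.1 i.2 y / √(i.1.factorial)|)]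

lemma abs_le_sqrt (h : IsFeatureMap ψ k) {M : ℝ} (hM : ∀ x, k x x ≤ M) (i : ι) (x : α) :
    |ψ i x| ≤ √M := by
  refine Real.abs_le_sqrt (le_trans ?_ (hM x))
  exact le_hasSum (h.hasSum_sq x) i fun _ _ => sq_nonneg _

lemma integrable (h : IsFeatureMap ψ k) {M : ℝ} (hM : ∀ x, k x x ≤ M)
    (ν : Measure α) [IsFiniteMeasure ν] (i : ι) : Integrable (ψ i) ν :=
  .of_bound (h.measurable i).aestronglyMeasurable (√M)
    (.of_forall fun x => h.abs_le_sqrt hM i x)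

lemma integrable_sq (h : IsFeatureMap ψ k) {M : ℝ} (hM : ∀ x, k x x ≤ M)
    (ν : Measure α) [IsFiniteMeasure ν] (i : ι) : Integrable (fun x => ψ i x ^ 2) ν :=
  .of_bound ((h.measurable i).pow_const 2).aestronglyMeasurable (√M ^ 2)
    (.of_forall fun x => by
      rw [norm_pow]; exact pow_le_pow_left₀ (norm_nonneg _) (h.abs_le_sqrt hM i x) 2)

/-- Every partial sum of the squared features is at most the diagonal value of the kernel, hence at
most `M`. -/
lemma summable_integral_sq (h : IsFeatureMap ψ k) {M : ℝ} (hM : ∀ x, k x x ≤ M)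
    (ν : Measure α) [IsProbabilityMeasure ν] : Summable fun i => ∫ x, ψ i x ^ 2 ∂ν := by
  refine summable_of_sum_le (c := M) (fun i => integral_nonneg fun x => sq_nonneg _) fun s => ?_
  rw [← integral_finsetSum _ fun i _ => h.integrable_sq hM ν i]
  calc ∫ x, ∑ i ∈ s, ψ i x ^ 2 ∂ν ≤ ∫ _, M ∂ν := by
        refine integral_mono (integrable_finsetSum _ fun i _ => h.integrable_sq hM ν i)
          (integrable_const _) fun x => ?_
        exact (sum_le_hasSum s (fun _ _ => sq_nonneg _) (h.hasSum_sq x)).trans (hM x)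
    _ = M := by simp

/-- The energy of a probability measure is the sum of the squared means of the features. -/
lemma hasSum_sq_integral [Countable ι] (h : IsFeatureMap ψ k) {M : ℝ} (hM : ∀ x, k x x ≤ M)
    (ν : Measure α) [IsProbabilityMeasure ν] :
    HasSum (fun i => (∫ x, ψ i x ∂ν) ^ 2) (∫ p, k p.1 p.2 ∂ν.prod ν) := by
  have hint (i : ι) : Integrable (fun p : α × α => ψ i p.1 * ψ i p.2) (ν.prod ν) :=
    (h.integrable hM ν i).mul_prod (h.integrable hM ν i)
  have h1 (i : ι) : Integrable (fun p : α × α => ψ i p.1 ^ 2) (ν.prod ν) :=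
    (h.integrable_sq hM ν i).comp_fst ν
  have h2 (i : ι) : Integrable (fun p : α × α => ψ i p.2 ^ 2) (ν.prod ν) :=
    (h.integrable_sq hM ν i).comp_snd ν
  have := hasSum_integral_of_summable_integral_norm hint ?_
  · simp only [integral_prod_mul, (h.hasSum _ _).tsum_eq] at this
    simpa only [sq] using this
  -- The inequality `|uv| ≤ u² + v²` supplies the absolute summability that allows summation and
  -- integration to be interchanged.
  · refine ((h.summable_integral_sq hM ν).add (h.summable_integral_sq hM ν)).of_nonneg_of_le
      (fun i => integral_nonneg fun _ => norm_nonneg _) fun i => ?_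
    have e1 : ∫ x, ψ i x ^ 2 ∂ν = ∫ p : α × α, ψ i p.1 ^ 2 ∂ν.prod ν := by
      rw [integral_fun_fst (fun x => ψ i x ^ 2)]; simp
    have e2 : ∫ x, ψ i x ^ 2 ∂ν = ∫ p : α × α, ψ i p.2 ^ 2 ∂ν.prod ν := by
      rw [integral_fun_snd (fun x => ψ i x ^ 2)]; simp
    nth_rewrite 1 [e1]
    rw [e2, ← integral_add (h1 i) (h2 i)]
    refine integral_mono (hint i).norm ((h1 i).add (h2 i)) fun p => ?_
    simp only [Real.norm_eq_abs]
    exact abs_le.2 ⟨by nlinarith [sq_nonneg (ψ i p.1 + ψ i p.2)],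
      by nlinarith [sq_nonneg (ψ i p.1 - ψ i p.2)]⟩

/-- The mean of a section of the kernel is determined by the means of the features. -/
lemma hasSum_integral_mul [Countable ι] (h : IsFeatureMap ψ k) {M : ℝ} (hM : ∀ x, k x x ≤ M)
    (ν : Measure α) [IsProbabilityMeasure ν] (y : α) :
    HasSum (fun i => (∫ x, ψ i x ∂ν) * ψ i y) (∫ x, k x y ∂ν) := by
  have hint (i : ι) : Integrable (fun x => ψ i x * ψ i y) ν := (h.integrable hM ν i).mul_const _
  have := hasSum_integral_of_summable_integral_norm hint ?_
  · simpa only [integral_mul_const, (h.hasSum _ _).tsum_eq] using this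
  · refine ((h.summable_integral_sq hM ν).add (h.hasSum_sq y).summable).of_nonneg_of_le
      (fun i => integral_nonneg fun _ => norm_nonneg _) fun i => ?_
    have e : ∫ x, (ψ i x ^ 2 + ψ i y ^ 2) ∂ν = ∫ x, ψ i x ^ 2 ∂ν + ψ i y ^ 2 := by
      rw [integral_add (h.integrable_sq hM ν i) (integrable_const _)]; simp
    rw [← e]
    refine integral_mono (hint i).norm ((h.integrable_sq hM ν i).add (integrable_const _))
      fun p => ?_
    simp only [Real.norm_eq_abs]
    exact abs_le.2 ⟨by nlinarith [sq_nonneg (ψ i p + ψ i y)],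
      by nlinarith [sq_nonneg (ψ i p - ψ i y)]⟩

end IsFeatureMap

/-! ### The Gaussian kernel -/

/-- The Gaussian kernel `exp (-‖x - y‖² / 2)`. -/
def gaussKernel {H : Type*} [NormedAddCommGroup H] (x y : H) : ℝ := Real.exp (-‖x - y‖ ^ 2 / 2)

lemma gaussKernel_self {H : Type*} [NormedAddCommGroup H] (x : H) : gaussKernel x x = 1 := by
  simp [gaussKernel]

section Hilbert

universe u

variable {H : Type u} [NormedAddCommGroup H] [InnerProductSpace ℝ H] [CompleteSpace H]
    [TopologicalSpace.SeparableSpace H] [MeasurableSpace H] [BorelSpace H]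

lemma exists_isFeatureMap_inner : ∃ (ι : Type u) (_ : Countable ι) (ψ : ι → H → ℝ),
    IsFeatureMap ψ (fun x y => inner ℝ x y) := by
  obtain ⟨w, b, -⟩ := exists_hilbertBasis ℝ H
  refine ⟨w, ?_, fun i x => inner ℝ x (b i), fun i => ?_, fun x y => ?_⟩
  -- Distinct basis vectors are at distance `√2 > 1`, so the balls of radius `1/2` are disjoint, and
  -- separability leaves only countably many.
  · refine Set.PairwiseDisjoint.countable_of_isOpen (s := fun i : w => Metric.ball (b i) (1 / 2))
      (a := Set.univ) (fun i _ j _ hij => ?_) (fun i _ => Metric.isOpen_ball)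
      (fun i _ => ⟨b i, Metric.mem_ball_self (by norm_num)⟩) |> Set.countable_univ_iff.1
    refine Metric.ball_disjoint_ball ?_
    have h2 : ‖b i - b j‖ ^ 2 = 2 := by
      rw [norm_sub_sq_real, b.orthonormal.1 i, b.orthonormal.1 j, b.orthonormal.2 hij]
      norm_num
    rw [dist_eq_norm]
    nlinarith [norm_nonneg (b i - b j)]
  · exact (continuous_id.inner continuous_const).measurable
  · simpa only [real_inner_comm y] using b.hasSum_inner_mul_inner x y

lemma exists_isFeatureMap_inner_pow (n : ℕ) : ∃ (ι : Type u) (_ : Countable ι) (ψ : ι → H → ℝ),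
    IsFeatureMap ψ (fun x y => inner ℝ x y ^ n) := by
  induction n with
  | zero =>
    refine ⟨PUnit, inferInstance, fun _ _ => 1, fun _ => measurable_const, fun x y => ?_⟩
    simp
  | succ n ih =>
    obtain ⟨ι, _, ψ, h⟩ := ih
    obtain ⟨κ, _, φ, h'⟩ := exists_isFeatureMap_inner (H := H)
    exact ⟨ι × κ, inferInstance, _, by simpa only [pow_succ] using h.mul h'⟩

/-- Expanding the square factors the kernel into `exp ⟪x, y⟫`, a power series in inner products, and
a kernel with a single feature. -/
lemma exists_isFeatureMap_gaussKernel : ∃ (ι : Type u) (_ : Countable ι) (ψ : ι → H → ℝ),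
    IsFeatureMap ψ (gaussKernel (H := H)) := by
  choose ι hι ψ h using exists_isFeatureMap_inner_pow (H := H)
  have h1 : IsFeatureMap (fun (_ : Unit) (x : H) => Real.exp (-‖x‖ ^ 2 / 2))
      (fun x y => Real.exp (-‖x‖ ^ 2 / 2) * Real.exp (-‖y‖ ^ 2 / 2)) :=
    ⟨fun _ => (by fun_prop : Continuous fun x : H => Real.exp (-‖x‖ ^ 2 / 2)).measurable,
      fun x y => by simp⟩
  have e : gaussKernel (H := H) = fun x y => Real.exp (inner ℝ x y) *
      (Real.exp (-‖x‖ ^ 2 / 2) * Real.exp (-‖y‖ ^ 2 / 2)) := by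
    funext x y
    rw [gaussKernel, ← Real.exp_add, ← Real.exp_add, norm_sub_sq_real]
    congr 1
    ring
  rw [e]
  exact ⟨(Σ n, ι n) × Unit, inferInstance, _, (IsFeatureMap.exp h).mul h1⟩

end Hilbert

/-! ### The Hilbert–Schmidt independence criterion -/

/-- The alternating sum of a kernel along the edges of a quadrilateral. -/
def quad {α : Type*} (a : α → α → ℝ) (x₀ x₁ x₂ x₃ : α) : ℝ :=
  a x₀ x₁ - a x₁ x₂ + a x₂ x₃ - a x₃ x₀

/-- The mean of `quad a * quad b` for four independent pairs with law `μ`; the zeroth and the second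
pair form the first component of `z`, the first and the third pair its second component. -/
def hsic {α γ : Type*} [MeasurableSpace α] [MeasurableSpace γ] (a : α → α → ℝ) (b : γ → γ → ℝ)
    (μ : Measure (α × γ)) : ℝ :=
  ∫ z, quad a z.1.1.1 z.2.1.1 z.1.2.1 z.2.2.1 * quad b z.1.1.2 z.2.1.2 z.1.2.2 z.2.2.2
    ∂((μ.prod μ).prod (μ.prod μ))

/-- Two independent copies express a covariance without centring. The product is bilinear, without
conjugation; real scalars serve the features, complex ones the characters. -/
lemma integral_sub_mul_sub {α 𝕜 : Type*} [MeasurableSpace α] [RCLike 𝕜] (μ : Measure α)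
    [IsProbabilityMeasure μ] {f g : α → 𝕜} (hf : Integrable f μ) (hg : Integrable g μ)
    (hfg : Integrable (fun x => f x * g x) μ) :
    ∫ p, (f p.1 - f p.2) * (g p.1 - g p.2) ∂μ.prod μ
      = 2 * (∫ x, f x * g x ∂μ - (∫ x, f x ∂μ) * ∫ x, g x ∂μ) := by
  have e : (fun p : α × α => (f p.1 - f p.2) * (g p.1 - g p.2)) = fun p =>
      (f p.1 * g p.1 + f p.2 * g p.2) - (f p.1 * g p.2 + g p.1 * f p.2) := by
    funext p; ring
  have h1 := hfg.comp_fst μ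
  have h2 := hfg.comp_snd μ
  have h3 := hf.mul_prod hg
  have h4 := hg.mul_prod hf
  rw [e]
  refine (integral_sub (h1.add h2) (h3.add h4)).trans
    ((congrArg₂ _ (integral_add h1 h2) (integral_add h3 h4)).trans ?_)
  rw [integral_prod_mul, integral_prod_mul, integral_fun_fst (fun x => f x * g x),
    integral_fun_snd (fun x => f x * g x)]
  simp only [probReal_univ, one_smul]
  ring

section Features

variable {ι κ α γ : Type*} [MeasurableSpace α] [MeasurableSpace γ]
  {ψ : ι → α → ℝ} {φ : κ → γ → ℝ} {a : α → α → ℝ} {b : γ → γ → ℝ}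

lemma IsFeatureMap.quad (h : IsFeatureMap ψ a) :
    IsFeatureMap (fun i (p : α × α) => ψ i p.1 - ψ i p.2)
      (fun p q => quad a p.1 q.1 p.2 q.2) := h.sub_sub

lemma IsFeatureMap.quad_self_nonneg (h : IsFeatureMap ψ a) (x y : α) :
    0 ≤ DistCov.quad a x x y y :=
  (h.quad.hasSum_sq (x, y)).nonneg fun _ => sq_nonneg _

lemma IsFeatureMap.quad_self_le (h : IsFeatureMap ψ a) (h1 : ∀ x, a x x ≤ 1) (x y : α) :
    DistCov.quad a x x y y ≤ 4 := by
  refine (hasSum_le (fun i => ?_) (h.quad.hasSum_sq (x, y))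
    (((h.hasSum_sq x).add (h.hasSum_sq y)).mul_left 2)).trans ?_
  · nlinarith [sq_nonneg (ψ i x + ψ i y)]
  · linarith [h1 x, h1 y]

/-- The product of the two alternating sums is a kernel on pairs of points of `α × γ`, whose
features are products of differences, and `hsic` is its energy under `μ.prod μ`. The mean of such a
feature is twice a covariance. -/
lemma IsFeatureMap.hasSum_hsic [Countable ι] [Countable κ] (h : IsFeatureMap ψ a)
    (h' : IsFeatureMap φ b) (h1 : ∀ x, a x x ≤ 1) (h1' : ∀ x, b x x ≤ 1)
    (μ : Measure (α × γ)) [IsProbabilityMeasure μ] :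
    HasSum (fun i : ι × κ => (2 * (∫ z, ψ i.1 z.1 * φ i.2 z.2 ∂μ
      - (∫ z, ψ i.1 z.1 ∂μ) * ∫ z, φ i.2 z.2 ∂μ)) ^ 2) (hsic a b μ) := by
  have hp := ((h.comp (measurable_fst (α := α) (β := γ))).quad).mul
    ((h'.comp (measurable_snd (α := α) (β := γ))).quad)
  have hM (p : (α × γ) × (α × γ)) :
      DistCov.quad a p.1.1 p.1.1 p.2.1 p.2.1 * DistCov.quad b p.1.2 p.1.2 p.2.2 p.2.2 ≤ 4 * 4 :=
    mul_le_mul (h.quad_self_le h1 _ _) (h'.quad_self_le h1' _ _) (h'.quad_self_nonneg _ _)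
      (by norm_num)
  have := hp.hasSum_sq_integral (M := 4 * 4) hM (μ.prod μ)
  have e (i : ι × κ) := integral_sub_mul_sub μ (f := fun z => ψ i.1 z.1) (g := fun z => φ i.2 z.2)
    ((h.comp measurable_fst).integrable (fun z => h1 z.1) μ i.1)
    ((h'.comp measurable_snd).integrable (fun z => h1' z.2) μ i.2)
    (((h.comp measurable_fst).mul (h'.comp measurable_snd)).integrable (M := 1 * 1)
      (fun z => mul_le_mul (h1 z.1) (h1' z.2)
        ((h'.hasSum_sq z.2).nonneg fun _ => sq_nonneg _) zero_le_one) μ i)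
  simp only [e] at this
  exact this

lemma IsFeatureMap.hsic_nonneg [Countable ι] [Countable κ] (h : IsFeatureMap ψ a)
    (h' : IsFeatureMap φ b) (h1 : ∀ x, a x x ≤ 1) (h1' : ∀ x, b x x ≤ 1)
    (μ : Measure (α × γ)) [IsProbabilityMeasure μ] : 0 ≤ hsic a b μ :=
  (h.hasSum_hsic h' h1 h1' μ).nonneg fun _ => sq_nonneg _

lemma IsFeatureMap.hsic_eq_zero_iff [Countable ι] [Countable κ] (h : IsFeatureMap ψ a)
    (h' : IsFeatureMap φ b) (h1 : ∀ x, a x x ≤ 1) (h1' : ∀ x, b x x ≤ 1)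
    (μ : Measure (α × γ)) [IsProbabilityMeasure μ] :
    hsic a b μ = 0 ↔ ∀ i j, ∫ z, ψ i z.1 * φ j z.2 ∂μ = (∫ z, ψ i z.1 ∂μ) * ∫ z, φ j z.2 ∂μ := by
  have hs := h.hasSum_hsic h' h1 h1' μ
  constructor
  · intro h0 i j
    rw [h0] at hs
    have := congrFun ((hasSum_zero_iff_of_nonneg fun _ => sq_nonneg _).1 hs) (i, j)
    simp only [Pi.zero_apply, ne_eq, OfNat.ofNat_ne_zero, not_false_eq_true, pow_eq_zero_iff,
      mul_eq_zero, false_or] at this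
    exact sub_eq_zero.1 this
  · intro h0
    simp only [h0, sub_self, mul_zero, ne_eq, OfNat.ofNat_ne_zero, not_false_eq_true,
      zero_pow] at hs
    exact hs.unique hasSum_zero

/-- The product features have the same means under `μ` and under the product of its marginals, and
these means determine the integrals of the product kernel. -/
lemma IsFeatureMap.integral_eq_of_hsic_eq_zero [Countable ι] [Countable κ] (h : IsFeatureMap ψ a)
    (h' : IsFeatureMap φ b) (h1 : ∀ x, a x x ≤ 1) (h1' : ∀ x, b x x ≤ 1)
    (μ : Measure (α × γ)) [IsProbabilityMeasure μ] (h0 : hsic a b μ = 0) (x : α) (y : γ) :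
    ∫ z, a z.1 x * b z.2 y ∂μ = ∫ z, a z.1 x * b z.2 y ∂(μ.fst.prod μ.snd) := by
  have hp := (h.comp (measurable_fst (α := α) (β := γ))).mul (h'.comp measurable_snd)
  have hM (z : α × γ) : a z.1 z.1 * b z.2 z.2 ≤ 1 * 1 := mul_le_mul (h1 z.1) (h1' z.2)
    ((h'.hasSum_sq z.2).nonneg fun _ => sq_nonneg _) zero_le_one
  refine (hp.hasSum_integral_mul hM μ (x, y)).unique ?_
  convert hp.hasSum_integral_mul hM (μ.fst.prod μ.snd) (x, y) using 3 with i
  rw [(h.hsic_eq_zero_iff h' h1 h1' μ).1 h0, integral_prod_mul, Measure.fst, Measure.snd,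
    integral_map (by fun_prop) (h.measurable _).aestronglyMeasurable,
    integral_map (by fun_prop) (h'.measurable _).aestronglyMeasurable]

end Features

/-- The norm of `H × K` is the maximum norm, so Riesz representation is applied on each factor. -/
lemma exists_dual_prod_eq_inner {H K : Type*}
    [NormedAddCommGroup H] [InnerProductSpace ℝ H] [CompleteSpace H]
    [NormedAddCommGroup K] [InnerProductSpace ℝ K] [CompleteSpace K] (L : StrongDual ℝ (H × K)) :
    ∃ (x : H) (y : K), ∀ z, L z = inner ℝ x z.1 + inner ℝ y z.2 := by
  refine ⟨(InnerProductSpace.toDual ℝ H).symm (L.comp (.inl ℝ H K)),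
    (InnerProductSpace.toDual ℝ K).symm (L.comp (.inr ℝ H K)), fun z => ?_⟩
  simp only [InnerProductSpace.toDual_symm_apply, ContinuousLinearMap.comp_apply,
    ContinuousLinearMap.inl_apply, ContinuousLinearMap.inr_apply, ← map_add]
  simp

section Hilbert

variable {H K : Type*}
    [NormedAddCommGroup H] [InnerProductSpace ℝ H] [CompleteSpace H]
    [TopologicalSpace.SeparableSpace H] [MeasurableSpace H] [BorelSpace H]
    [NormedAddCommGroup K] [InnerProductSpace ℝ K] [CompleteSpace K]
    [TopologicalSpace.SeparableSpace K] [MeasurableSpace K] [BorelSpace K]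

/-- Probability measures on a product of Hilbert spaces are determined by their integrals against
products of Gaussian kernels. -/
lemma ext_of_integral_gaussKernel {μ ν : Measure (H × K)} [IsProbabilityMeasure μ]
    [IsProbabilityMeasure ν]
    (h : ∀ x y, ∫ z, gaussKernel z.1 x * gaussKernel z.2 y ∂μ
      = ∫ z, gaussKernel z.1 x * gaussKernel z.2 y ∂ν) : μ = ν := by
  have : SecondCountableTopology H := UniformSpace.secondCountable_of_separable H
  have : SecondCountableTopology K := UniformSpace.secondCountable_of_separable K
  -- The measures are weighted by a Gaussian so that all exponential moments become finite.
  set w : H × K → ℝ := fun z => gaussKernel z.1 0 * gaussKernel z.2 0 with hw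
  have hwc : Continuous w := by
    simp only [hw, gaussKernel]; fun_prop
  have hwpos (z) : 0 < w z := mul_pos (Real.exp_pos _) (Real.exp_pos _)
  have hwle (z) : w z ≤ 1 := by
    simp only [hw, gaussKernel, ← Real.exp_add, Real.exp_le_one_iff]
    nlinarith [sq_nonneg ‖z.1 - 0‖, sq_nonneg ‖z.2 - 0‖]
  have hwm : Measurable fun z => ENNReal.ofReal (w z) := hwc.measurable.ennreal_ofReal
  -- Completing the square: an exponential of a functional, times the weight, is a multiple of a
  -- product of Gaussian kernels centred at `t • x` and `t • y`.
  have key (L : StrongDual ℝ (H × K)) (t : ℝ) : ∃ (x : H) (y : K) (c : ℝ), 0 ≤ c ∧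
      ∀ z, w z * Real.exp (t * L z) = c * (gaussKernel z.1 x * gaussKernel z.2 y) := by
    obtain ⟨x, y, hxy⟩ := exists_dual_prod_eq_inner L
    refine ⟨t • x, t • y, Real.exp ((‖t • x‖ ^ 2 + ‖t • y‖ ^ 2) / 2), (Real.exp_pos _).le,
      fun z => ?_⟩
    simp only [hw, gaussKernel, ← Real.exp_add, hxy]
    congr 1
    rw [norm_sub_sq_real _ (t • x), norm_sub_sq_real _ (t • y), real_inner_smul_right,
      real_inner_smul_right,
      real_inner_comm x, real_inner_comm y]
    simp only [sub_zero]
    ring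
  have hfin (μ : Measure (H × K)) [IsProbabilityMeasure μ] :
      IsFiniteMeasure (μ.withDensity fun z => ENNReal.ofReal (w z)) := by
    refine isFiniteMeasure_withDensity_ofReal ?_
    exact (Integrable.of_bound hwc.aestronglyMeasurable 1 (.of_forall fun z => by
      rw [Real.norm_eq_abs, abs_of_pos (hwpos z)]; exact hwle z)).2
  have hint (μ : Measure (H × K)) [IsProbabilityMeasure μ] (L : StrongDual ℝ (H × K)) (t : ℝ) :
      Integrable (fun z => Real.exp (t * L z)) (μ.withDensity fun z => ENNReal.ofReal (w z)) := by
    obtain ⟨x, y, c, hc, e⟩ := key L t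
    rw [integrable_withDensity_iff_integrable_smul₀' hwm.aemeasurable (by simp)]
    refine Integrable.of_bound (by fun_prop) c (.of_forall fun z => ?_)
    rw [ENNReal.toReal_ofReal (hwpos z).le, smul_eq_mul, e, Real.norm_eq_abs, abs_mul,
      abs_of_nonneg hc]
    refine mul_le_of_le_one_right hc ?_
    rw [gaussKernel, gaussKernel, ← Real.exp_add, Real.abs_exp, Real.exp_le_one_iff]
    nlinarith [sq_nonneg ‖z.1 - x‖, sq_nonneg ‖z.2 - y‖]
  have hmgf (L : StrongDual ℝ (H × K)) : mgf L (μ.withDensity fun z => ENNReal.ofReal (w z))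
      = mgf L (ν.withDensity fun z => ENNReal.ofReal (w z)) := by
    funext t
    obtain ⟨x, y, c, hc, e⟩ := key L t
    have (μ : Measure (H × K)) : mgf L (μ.withDensity fun z => ENNReal.ofReal (w z)) t
        = c * ∫ z, gaussKernel z.1 x * gaussKernel z.2 y ∂μ := by
      rw [mgf, integral_withDensity_eq_integral_toReal_smul hwm (by simp), ← integral_const_mul]
      refine integral_congr_ae (.of_forall fun z => ?_)
      simp only [ENNReal.toReal_ofReal (hwpos z).le, smul_eq_mul, e]
    rw [this, this, h]
  have := hfin μ
  have := hfin ν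
  have heq : (μ.withDensity fun z => ENNReal.ofReal (w z))
      = ν.withDensity fun z => ENNReal.ofReal (w z) := by
    -- The moment generating functions agree and are finite on the whole line, so by analytic
    -- continuation the complex ones agree on the whole plane, the imaginary axis included.
    refine Measure.ext_of_charFunDual ?_
    funext L
    have hset : integrableExpSet L (μ.withDensity fun z => ENNReal.ofReal (w z)) = Set.univ :=
      Set.eq_univ_of_forall fun t => hint μ L t
    have h0 : (μ.withDensity fun z => ENNReal.ofReal (w z)) = 0
        ↔ (ν.withDensity fun z => ENNReal.ofReal (w z)) = 0 := by
      have := congrFun (hmgf L) 0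
      simp only [mgf_zero'] at this
      rw [← Measure.measure_univ_eq_zero, ← Measure.measure_univ_eq_zero,
        ← measureReal_eq_zero_iff, ← measureReal_eq_zero_iff, this]
    have hc := eqOn_complexMGF_of_mgf' (hmgf L) h0
    rw [hset] at hc
    rw [charFunDual_eq_charFun_map_one, charFunDual_eq_charFun_map_one,
      Measure.ext_of_complexMGF_eq (by fun_prop) (by fun_prop)
        (funext fun z => hc (by simp) : complexMGF L _ = complexMGF L _)]
  -- The weight is positive everywhere, so it can be divided out again.
  have hinv (μ : Measure (H × K)) :
      (μ.withDensity fun z => ENNReal.ofReal (w z)).withDensity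
        (fun z => (ENNReal.ofReal (w z))⁻¹) = μ :=
    withDensity_inv_same hwm (.of_forall fun z => by simp [hwpos z]) (.of_forall fun z => by simp)
  rw [← hinv μ, heq, hinv ν]

/-- The Gaussian kernel with the scale `r`. -/
def scaledKernel {H : Type*} [NormedAddCommGroup H] [NormedSpace ℝ H] (r : ℝ) (x y : H) : ℝ :=
  gaussKernel (r • x) (r • y)

lemma scaledKernel_self {H : Type*} [NormedAddCommGroup H] [NormedSpace ℝ H] (r : ℝ) (x : H) :
    scaledKernel r x x = 1 := gaussKernel_self _

lemma isFeatureMap_scaledKernel {ι : Type*} {ψ : ι → H → ℝ}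
    (h : IsFeatureMap ψ (gaussKernel (H := H))) (r : ℝ) :
    IsFeatureMap (fun i x => ψ i (r • x)) (scaledKernel (H := H) r) :=
  h.comp (measurable_const_smul r)

lemma hsic_scaledKernel_nonneg (r s : ℝ) (μ : Measure (H × K)) [IsProbabilityMeasure μ] :
    0 ≤ hsic (scaledKernel r) (scaledKernel s) μ := by
  obtain ⟨ι, _, ψ, h⟩ := exists_isFeatureMap_gaussKernel (H := H)
  obtain ⟨κ, _, φ, h'⟩ := exists_isFeatureMap_gaussKernel (H := K)
  exact (isFeatureMap_scaledKernel h r).hsic_nonneg (isFeatureMap_scaledKernel h' s)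
    (fun x => (scaledKernel_self r x).le) (fun x => (scaledKernel_self s x).le) μ

lemma hsic_scaledKernel_prod (r s : ℝ) (μ : Measure H) (ν : Measure K) [IsProbabilityMeasure μ]
    [IsProbabilityMeasure ν] : hsic (scaledKernel r) (scaledKernel s) (μ.prod ν) = 0 := by
  obtain ⟨ι, _, ψ, h⟩ := exists_isFeatureMap_gaussKernel (H := H)
  obtain ⟨κ, _, φ, h'⟩ := exists_isFeatureMap_gaussKernel (H := K)
  refine ((isFeatureMap_scaledKernel h r).hsic_eq_zero_iff (isFeatureMap_scaledKernel h' s)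
    (fun x => (scaledKernel_self r x).le) (fun x => (scaledKernel_self s x).le) _).2 fun i j => ?_
  rw [integral_prod_mul (fun x => ψ i (r • x)) (fun y => φ j (s • y)),
    integral_fun_fst (fun x => ψ i (r • x)), integral_fun_snd (fun y => φ j (s • y))]
  simp

lemma eq_prod_of_hsic_scaledKernel_eq_zero {r s : ℝ} (hr : r ≠ 0) (hs : s ≠ 0)
    (μ : Measure (H × K)) [IsProbabilityMeasure μ]
    (h0 : hsic (scaledKernel r) (scaledKernel s) μ = 0) : μ = μ.fst.prod μ.snd := by
  have : SecondCountableTopology H := UniformSpace.secondCountable_of_separable H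
  have : SecondCountableTopology K := UniformSpace.secondCountable_of_separable K
  obtain ⟨ι, _, ψ, h⟩ := exists_isFeatureMap_gaussKernel (H := H)
  obtain ⟨κ, _, φ, h'⟩ := exists_isFeatureMap_gaussKernel (H := K)
  have key := (isFeatureMap_scaledKernel h r).integral_eq_of_hsic_eq_zero
    (isFeatureMap_scaledKernel h' s) (fun x => (scaledKernel_self r x).le)
    (fun x => (scaledKernel_self s x).le) μ h0
  have hg : Measurable fun z : H × K => (r • z.1, s • z.2) := by fun_prop
  have hg' : Measurable fun z : H × K => (r⁻¹ • z.1, s⁻¹ • z.2) := by fun_prop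
  -- A dilation by `r` and `s` reduces the scaled kernels to those of scale one; it is undone
  -- afterwards because both scales are nonzero.
  have hmap : μ.map (fun z : H × K => (r • z.1, s • z.2))
      = (μ.fst.prod μ.snd).map (fun z : H × K => (r • z.1, s • z.2)) := by
    have := Measure.isProbabilityMeasure_map (μ := μ) hg.aemeasurable
    have := Measure.isProbabilityMeasure_map (μ := μ.fst.prod μ.snd) hg.aemeasurable
    refine ext_of_integral_gaussKernel fun x y => ?_
    have hc : Continuous fun z : H × K => gaussKernel z.1 x * gaussKernel z.2 y := by
      simp only [gaussKernel]; fun_prop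
    rw [integral_map hg.aemeasurable hc.aestronglyMeasurable,
      integral_map hg.aemeasurable hc.aestronglyMeasurable]
    simpa only [scaledKernel, smul_inv_smul₀ hr, smul_inv_smul₀ hs] using key (r⁻¹ • x) (s⁻¹ • y)
  have hid (ν : Measure (H × K)) : (ν.map (fun z : H × K => (r • z.1, s • z.2))).map
      (fun z : H × K => (r⁻¹ • z.1, s⁻¹ • z.2)) = ν := by
    rw [Measure.map_map hg' hg]
    simp [Function.comp_def, inv_smul_smul₀ hr, inv_smul_smul₀ hs]
  exact (hid μ).symm.trans (hmap ▸ hid _)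

attribute [irreducible] scaledKernel

end Hilbert

/-! ### Powers of the distance as mixtures of Gaussian kernels -/

/-- The measure `r ^ (-β-1) dr` on the positive half line. -/
def powMeasure (β : ℝ) : Measure ℝ :=
  (volume.restrict (Set.Ioi 0)).withDensity fun r => ENNReal.ofReal (r ^ (-(β + 1)))

instance (β : ℝ) : SigmaFinite (powMeasure β) := by unfold powMeasure; infer_instance

lemma measurable_powDensity (β : ℝ) : Measurable fun r : ℝ => ENNReal.ofReal (r ^ (-(β + 1))) :=
  (measurable_id.pow_const _).ennreal_ofReal

lemma ae_pos_powMeasure (β : ℝ) : ∀ᵐ r ∂powMeasure β, 0 < r :=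
  (withDensity_absolutelyContinuous _ _).ae_le (ae_restrict_mem measurableSet_Ioi)

lemma integrable_powMeasure_iff {β : ℝ} {f : ℝ → ℝ} : Integrable f (powMeasure β)
    ↔ IntegrableOn (fun r => r ^ (-(β + 1)) * f r) (Set.Ioi 0) := by
  rw [powMeasure, integrable_withDensity_iff_integrable_smul₀'
    (measurable_powDensity β).aemeasurable (by simp)]
  refine integrable_congr ?_
  filter_upwards [ae_restrict_mem measurableSet_Ioi] with r (hr : 0 < r)
  rw [ENNReal.toReal_ofReal (Real.rpow_nonneg hr.le _), smul_eq_mul]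

lemma integral_powMeasure {β : ℝ} {f : ℝ → ℝ} : ∫ r, f r ∂powMeasure β
    = ∫ r in Set.Ioi 0, r ^ (-(β + 1)) * f r := by
  rw [powMeasure, integral_withDensity_eq_integral_toReal_smul (measurable_powDensity β) (by simp)]
  refine integral_congr_ae ?_
  filter_upwards [ae_restrict_mem measurableSet_Ioi] with r (hr : 0 < r)
  rw [ENNReal.toReal_ofReal (Real.rpow_nonneg hr.le _), smul_eq_mul]

lemma one_sub_exp_nonneg (r : ℝ) : 0 ≤ 1 - Real.exp (-r ^ 2 / 2) := by
  rw [sub_nonneg, Real.exp_le_one_iff]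
  nlinarith [sq_nonneg r]

/-- Near `0` the second factor is at most `r²`, which leaves `r ^ (1 - β)`, integrable since `β <
2`; near infinity it is at most `1`, which leaves `r ^ (-β-1)`, integrable since `β > 0`. -/
lemma integrableOn_rpow_mul_one_sub_exp {β : ℝ} (hβ : 0 < β) (hβ' : β < 2) :
    IntegrableOn (fun r : ℝ => r ^ (-(β + 1)) * (1 - Real.exp (-r ^ 2 / 2))) (Set.Ioi 0) := by
  have hm : Measurable fun r : ℝ => r ^ (-(β + 1)) * (1 - Real.exp (-r ^ 2 / 2)) :=
    (measurable_id.pow_const _).mul (by fun_prop)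
  rw [← Set.Ioc_union_Ioi_eq_Ioi zero_le_one]
  refine IntegrableOn.union ?_ ?_
  · have h := (intervalIntegral.intervalIntegrable_rpow' (a := 0) (b := 1)
      (by linarith : -1 < 1 - β)).1
    refine Integrable.mono' h hm.aestronglyMeasurable ?_
    filter_upwards [ae_restrict_mem measurableSet_Ioc] with r hr
    rw [norm_mul, Real.norm_of_nonneg (Real.rpow_nonneg hr.1.le _),
      Real.norm_of_nonneg (one_sub_exp_nonneg r)]
    have h1 : 1 - Real.exp (-r ^ 2 / 2) ≤ r ^ (2 : ℝ) := by
      rw [Real.rpow_two]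
      nlinarith [Real.add_one_le_exp (-r ^ 2 / 2), sq_nonneg r]
    calc r ^ (-(β + 1)) * (1 - Real.exp (-r ^ 2 / 2)) ≤ r ^ (-(β + 1)) * r ^ (2 : ℝ) :=
          mul_le_mul_of_nonneg_left h1 (Real.rpow_nonneg hr.1.le _)
      _ = r ^ (1 - β) := by rw [← Real.rpow_add hr.1]; congr 1; ring
  · have h := integrableOn_Ioi_rpow_of_lt (by linarith : -(β + 1) < -1) zero_lt_one
    refine Integrable.mono' h hm.aestronglyMeasurable ?_
    filter_upwards [ae_restrict_mem measurableSet_Ioi] with r (hr : 1 < r)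
    rw [norm_mul, Real.norm_of_nonneg (Real.rpow_nonneg (by linarith) _),
      Real.norm_of_nonneg (one_sub_exp_nonneg r)]
    exact mul_le_of_le_one_right (Real.rpow_nonneg (by linarith) _)
      (by linarith [Real.exp_pos (-r ^ 2 / 2)])

/-- The integral of `1 - exp (-r² / 2)` with respect to `r ^ (-β-1) dr`. -/
def powConst (β : ℝ) : ℝ := ∫ r, (1 - Real.exp (-r ^ 2 / 2)) ∂powMeasure β

lemma powConst_pos {β : ℝ} (hβ : 0 < β) (hβ' : β < 2) : 0 < powConst β := by
  have hpos (r : ℝ) (hr : 0 < r) : 0 < r ^ (-(β + 1)) * (1 - Real.exp (-r ^ 2 / 2)) := by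
    refine mul_pos (Real.rpow_pos_of_pos hr _) (sub_pos.2 (Real.exp_lt_one_iff.2 ?_))
    nlinarith [pow_pos hr 2]
  rw [powConst, integral_powMeasure, integral_pos_iff_support_of_nonneg_ae
    ((ae_restrict_mem measurableSet_Ioi).mono fun r hr => (hpos r hr).le)
    (integrableOn_rpow_mul_one_sub_exp hβ hβ')]
  refine lt_of_lt_of_le ?_ (measure_mono (s := Set.Ioi 0) fun r hr => (hpos r hr).ne')
  simp

lemma neBot_ae_powMeasure {β : ℝ} (hβ : 0 < β) (hβ' : β < 2) : (powMeasure β) ≠ 0 := by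
  intro h
  have := powConst_pos hβ hβ'
  simp [powConst, h] at this

/-- The kernel `dist x y ^ β`. -/
def distKernel {H : Type*} [PseudoMetricSpace H] (β : ℝ) (x y : H) : ℝ := dist x y ^ β

lemma distKernel_comm {H : Type*} [PseudoMetricSpace H] (β : ℝ) (x y : H) :
    distKernel β x y = distKernel β y x := by
  rw [distKernel, dist_comm, distKernel]

lemma distKernel_nonneg {H : Type*} [PseudoMetricSpace H] (β : ℝ) (x y : H) :
    0 ≤ distKernel β x y :=
  Real.rpow_nonneg dist_nonneg _

section Dist

variable {H : Type*} [NormedAddCommGroup H] [NormedSpace ℝ H]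

lemma scaledKernel_eq (r : ℝ) (x y : H) :
    scaledKernel r x y = Real.exp (-(dist x y * r) ^ 2 / 2) := by
  rw [scaledKernel, gaussKernel, ← smul_sub, norm_smul, dist_eq_norm, Real.norm_eq_abs, mul_pow,
    mul_pow, sq_abs, mul_comm]

lemma scaledKernel_comm (r : ℝ) (x y : H) : scaledKernel r x y = scaledKernel r y x := by
  rw [scaledKernel_eq, scaledKernel_eq, dist_comm]

lemma rpow_mul_one_sub_scaledKernel {β : ℝ} {x y : H} (h : x ≠ y) {r : ℝ} (hr : 0 < r) :
    r ^ (-(β + 1)) * (1 - scaledKernel r x y) = dist x y ^ (β + 1) *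
      ((dist x y * r) ^ (-(β + 1)) * (1 - Real.exp (-(dist x y * r) ^ 2 / 2))) := by
  have hd := dist_pos.2 h
  rw [scaledKernel_eq, Real.mul_rpow hd.le hr.le, Real.rpow_neg hd.le]
  have := (Real.rpow_pos_of_pos hd (β + 1)).ne'
  field_simp

lemma integrable_one_sub_scaledKernel {β : ℝ} (hβ : 0 < β) (hβ' : β < 2) (x y : H) :
    Integrable (fun r => 1 - scaledKernel r x y) (powMeasure β) := by
  rcases eq_or_ne x y with rfl | hxy
  · simp [scaledKernel_self]
  rw [integrable_powMeasure_iff]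
  have h := ((integrableOn_Ioi_comp_mul_left_iff
    (fun r : ℝ => r ^ (-(β + 1)) * (1 - Real.exp (-r ^ 2 / 2))) 0 (dist_pos.2 hxy)).2
    (by simpa using integrableOn_rpow_mul_one_sub_exp hβ hβ')).const_mul (dist x y ^ (β + 1))
  exact IntegrableOn.congr_fun h (fun r hr => (rpow_mul_one_sub_scaledKernel hxy hr).symm)
    measurableSet_Ioi

/-- The substitution of `dist x y * r` for `r` extracts the factor `dist x y ^ (β + 1)` from the
density and loses one power of the distance to the differential. -/
lemma integral_one_sub_scaledKernel {β : ℝ} (hβ : 0 < β) (x y : H) :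
    ∫ r, (1 - scaledKernel r x y) ∂powMeasure β = powConst β * dist x y ^ β := by
  rcases eq_or_ne x y with rfl | hxy
  · simp [scaledKernel_self, Real.zero_rpow hβ.ne']
  have hd := dist_pos.2 hxy
  rw [integral_powMeasure, setIntegral_congr_fun measurableSet_Ioi
    (fun r hr => rpow_mul_one_sub_scaledKernel hxy hr), integral_const_mul,
    integral_comp_mul_left_Ioi (fun r : ℝ => r ^ (-(β + 1)) * (1 - Real.exp (-r ^ 2 / 2))) 0 hd,
    mul_zero, powConst, integral_powMeasure, smul_eq_mul, ← mul_assoc, mul_comm _ (dist x y ^ β),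
    ← Real.rpow_neg_one, ← Real.rpow_add hd]
  congr 2
  ring

/-- The four signs add up to zero, so each kernel value may be replaced by its difference from `1`,
which is integrable over the scales while the kernel itself is not. -/
lemma quad_scaledKernel_eq (r : ℝ) (x₀ x₁ x₂ x₃ : H) : quad (scaledKernel r) x₀ x₁ x₂ x₃
    = -((1 - scaledKernel r x₀ x₁) - (1 - scaledKernel r x₁ x₂) + (1 - scaledKernel r x₂ x₃)
      - (1 - scaledKernel r x₃ x₀)) := by
  rw [quad]; ring

lemma integrable_quad_scaledKernel {β : ℝ} (hβ : 0 < β) (hβ' : β < 2) (x₀ x₁ x₂ x₃ : H) :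
    Integrable (fun r => quad (scaledKernel r) x₀ x₁ x₂ x₃) (powMeasure β) := by
  simp only [quad_scaledKernel_eq]
  exact ((((integrable_one_sub_scaledKernel hβ hβ' _ _).sub
    (integrable_one_sub_scaledKernel hβ hβ' _ _)).add
    (integrable_one_sub_scaledKernel hβ hβ' _ _)).sub
    (integrable_one_sub_scaledKernel hβ hβ' _ _)).neg

lemma integral_quad_scaledKernel {β : ℝ} (hβ : 0 < β) (hβ' : β < 2) (x₀ x₁ x₂ x₃ : H) :
    ∫ r, quad (scaledKernel r) x₀ x₁ x₂ x₃ ∂powMeasure β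
      = -(powConst β * quad (distKernel β) x₀ x₁ x₂ x₃) := by
  have h (x y : H) := integrable_one_sub_scaledKernel hβ hβ' x y
  simp only [quad_scaledKernel_eq]
  rw [integral_neg]
  have e := (integral_sub (((h x₀ x₁).sub (h x₁ x₂)).add (h x₂ x₃)) (h x₃ x₀)).trans
    (congrArg₂ _ ((integral_add ((h x₀ x₁).sub (h x₁ x₂)) (h x₂ x₃)).trans
      (congrArg₂ _ (integral_sub (h x₀ x₁) (h x₁ x₂)) rfl)) rfl)
  refine (congrArg _ e).trans ?_
  simp only [integral_one_sub_scaledKernel hβ, quad, distKernel]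
  ring

end Dist

/-- Cauchy–Schwarz in its weighted arithmetic-geometric form. The bound is linear in the diagonal
values, so it can be integrated over the scales before `t` is optimized. -/
lemma IsFeatureMap.abs_le {ι α : Type*} [MeasurableSpace α] {ψ : ι → α → ℝ} {k : α → α → ℝ}
    (h : IsFeatureMap ψ k) (x y : α) {t : ℝ} (ht : 0 < t) :
    |k x y| ≤ (t * k x x + t⁻¹ * k y y) / 2 := by
  have hb (i : ι) : |ψ i x * ψ i y| ≤ (t * ψ i x ^ 2 + t⁻¹ * ψ i y ^ 2) / 2 := by
    have h1 : 0 ≤ t⁻¹ * (t * |ψ i x| - |ψ i y|) ^ 2 := by positivity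
    have h2 : t⁻¹ * (t * |ψ i x| - |ψ i y|) ^ 2
        = t * ψ i x ^ 2 + t⁻¹ * ψ i y ^ 2 - 2 * (|ψ i x| * |ψ i y|) := by
      rw [← sq_abs (ψ i x), ← sq_abs (ψ i y)]
      field_simp
      ring
    rw [abs_mul]
    linarith
  have hs := (((h.hasSum_sq x).mul_left t).add ((h.hasSum_sq y).mul_left t⁻¹)).div_const 2
  refine _root_.abs_le.2 ⟨?_, hasSum_le (fun i => (le_abs_self _).trans (hb i)) (h.hasSum x y) hs⟩
  exact neg_le.1 (hasSum_le (fun i => (neg_le_abs _).trans (hb i)) (h.hasSum x y).neg hs)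

lemma le_two_mul_sqrt_of_forall_le {v a b : ℝ} (ha : 0 ≤ a) (hb : 0 ≤ b)
    (h : ∀ t : ℝ, 0 < t → v ≤ t * a + t⁻¹ * b) : v ≤ 2 * (√a * √b) := by
  rcases le_or_gt v 0 with hv | hv
  · exact hv.trans (by positivity)
  -- After multiplication by `t` the hypothesis says that `a t² - v t + b` is nonnegative; for `t ≤
  -- 0` this follows from `v > 0`. The discriminant also covers the cases `a = 0` and `b = 0`, in
  -- which no optimal `t` need exist.
  have hd : discrim a (-v) b ≤ 0 := by
    refine discrim_le_zero fun t => ?_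
    rcases le_or_gt t 0 with ht | ht
    · nlinarith [mul_nonneg ha (mul_self_nonneg t), mul_nonneg hv.le (neg_nonneg.2 ht)]
    · have := mul_le_mul_of_nonneg_left (h t ht) ht.le
      rw [mul_add, mul_inv_cancel_left₀ ht.ne'] at this
      linarith
  rw [discrim] at hd
  refine le_of_sq_le_sq ?_ (by positivity)
  rw [mul_pow, mul_pow, Real.sq_sqrt ha, Real.sq_sqrt hb]
  linarith

/-! ### A four-point inequality for Gaussian kernels and powers of distances -/

section Hilbert

variable {H : Type*}
    [NormedAddCommGroup H] [InnerProductSpace ℝ H] [CompleteSpace H]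
    [TopologicalSpace.SeparableSpace H] [MeasurableSpace H] [BorelSpace H]

/-- The alternating sum is a kernel evaluated at the two diagonals `(x₀, x₂)` and `(x₁, x₃)` of the
quadrilateral; on a repeated diagonal it equals `2 * (1 - scaledKernel r x₀ x₂)`, and likewise for
the other. -/
lemma abs_quad_scaledKernel_le (r : ℝ) (x₀ x₁ x₂ x₃ : H) {t : ℝ} (ht : 0 < t) :
    |quad (scaledKernel r) x₀ x₁ x₂ x₃|
      ≤ t * (1 - scaledKernel r x₀ x₂) + t⁻¹ * (1 - scaledKernel r x₁ x₃) := by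
  obtain ⟨ι, _, ψ, h⟩ := exists_isFeatureMap_gaussKernel (H := H)
  refine ((isFeatureMap_scaledKernel h r).quad.abs_le (x₀, x₂) (x₁, x₃) ht).trans (le_of_eq ?_)
  simp only [quad, scaledKernel_self, scaledKernel_comm r x₂ x₀, scaledKernel_comm r x₃ x₁]
  ring

lemma integral_abs_quad_scaledKernel_le {β : ℝ} (hβ : 0 < β) (hβ' : β < 2) (x₀ x₁ x₂ x₃ : H) :
    ∫ r, |quad (scaledKernel r) x₀ x₁ x₂ x₃| ∂powMeasure β
      ≤ powConst β * (2 * (√(distKernel β x₀ x₂) * √(distKernel β x₁ x₃))) := by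
  have hC := powConst_pos hβ hβ'
  rw [← div_le_iff₀' hC]
  refine le_two_mul_sqrt_of_forall_le (distKernel_nonneg _ _ _) (distKernel_nonneg _ _ _)
    fun t ht => ?_
  rw [div_le_iff₀' hC]
  have h (x y : H) := integrable_one_sub_scaledKernel hβ hβ' x y
  calc ∫ r, |quad (scaledKernel r) x₀ x₁ x₂ x₃| ∂powMeasure β
      ≤ ∫ r, (t * (1 - scaledKernel r x₀ x₂) + t⁻¹ * (1 - scaledKernel r x₁ x₃)) ∂powMeasure β :=
        integral_mono (integrable_quad_scaledKernel hβ hβ' _ _ _ _).abs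
          (((h _ _).const_mul t).add ((h _ _).const_mul t⁻¹))
          fun r => abs_quad_scaledKernel_le r x₀ x₁ x₂ x₃ ht
    _ = _ := by
        rw [integral_add ((h _ _).const_mul t) ((h _ _).const_mul t⁻¹), integral_const_mul,
          integral_const_mul, integral_one_sub_scaledKernel hβ, integral_one_sub_scaledKernel hβ,
          distKernel, distKernel]
        ring

/-- Cancellation halves the growth: the bound involves only square roots of the distance powers
along the diagonals. The product of two such bounds, one for each variable, is then integrable under
moments of order `β`. -/
lemma abs_quad_distKernel_le {β : ℝ} (hβ : 0 < β) (hβ' : β < 2) (x₀ x₁ x₂ x₃ : H) :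
    |quad (distKernel β) x₀ x₁ x₂ x₃| ≤ 2 * (√(distKernel β x₀ x₂) * √(distKernel β x₁ x₃)) := by
  have hC := powConst_pos hβ hβ'
  refine le_of_mul_le_mul_left ?_ hC
  refine le_trans ?_ (integral_abs_quad_scaledKernel_le hβ hβ' x₀ x₁ x₂ x₃)
  calc powConst β * |quad (distKernel β) x₀ x₁ x₂ x₃|
      = |∫ r, quad (scaledKernel r) x₀ x₁ x₂ x₃ ∂powMeasure β| := by
        rw [integral_quad_scaledKernel hβ hβ', abs_neg, abs_mul, abs_of_pos hC]
    _ ≤ _ := abs_integral_le_integral_abs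

end Hilbert

/-! ### Distance covariance as a mixture over pairs of scales -/

section Fubini

variable {H K : Type*}
    [NormedAddCommGroup H] [InnerProductSpace ℝ H] [CompleteSpace H]
    [TopologicalSpace.SeparableSpace H] [MeasurableSpace H] [BorelSpace H]
    [NormedAddCommGroup K] [InnerProductSpace ℝ K] [CompleteSpace K]
    [TopologicalSpace.SeparableSpace K] [MeasurableSpace K] [BorelSpace K]

lemma continuous_scaledKernel {H : Type*} [NormedAddCommGroup H] [NormedSpace ℝ H] :
    Continuous fun p : ℝ × H × H => scaledKernel p.1 p.2.1 p.2.2 := by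
  simp only [scaledKernel, gaussKernel]; fun_prop

lemma measurable_quad_scaledKernel {H : Type*} [NormedAddCommGroup H] [NormedSpace ℝ H]
    [TopologicalSpace.SeparableSpace H] [MeasurableSpace H] [BorelSpace H]
    {T : Type*} [MeasurableSpace T] {r : T → ℝ}
    {x₀ x₁ x₂ x₃ : T → H} (hr : Measurable r) (h0 : Measurable x₀) (h1 : Measurable x₁)
    (h2 : Measurable x₂) (h3 : Measurable x₃) :
    Measurable fun t => quad (scaledKernel (r t)) (x₀ t) (x₁ t) (x₂ t) (x₃ t) := by
  have : SecondCountableTopology H := UniformSpace.secondCountable_of_separable H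
  have hk : Measurable fun p : ℝ × H × H => scaledKernel p.1 p.2.1 p.2.2 :=
    continuous_scaledKernel.measurable
  have h {x y : T → H} (hx : Measurable x) (hy : Measurable y) :
      Measurable fun t => scaledKernel (r t) (x t) (y t) := by
    have hp : Measurable fun t => (r t, x t, y t) := hr.prodMk (hx.prodMk hy)
    simpa only [Function.comp_def] using hk.comp hp
  simp only [quad]
  exact (((h h0 h1).sub (h h1 h2)).add (h h2 h3)).sub (h h3 h0)

lemma measurable_distKernel {H : Type*} [PseudoMetricSpace H] [TopologicalSpace.SeparableSpace H]
    [MeasurableSpace H] [OpensMeasurableSpace H] {T : Type*} [MeasurableSpace T] (β : ℝ)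
    {x y : T → H} (hx : Measurable x) (hy : Measurable y) :
    Measurable fun t => distKernel β (x t) (y t) := by
  have : SecondCountableTopology H := UniformSpace.secondCountable_of_separable H
  exact (hx.dist hy).pow_const β

lemma integrable_sqrt_mul_sqrt {α : Type*} [MeasurableSpace α] {μ : Measure α} {f g : α → ℝ}
    (hf : Integrable f μ) (hg : Integrable g μ) (hf0 : ∀ x, 0 ≤ f x) (hg0 : ∀ x, 0 ≤ g x) :
    Integrable (fun x => √(f x) * √(g x)) μ := by
  refine (hf.add hg).mono' ((hf.1.aemeasurable.sqrt.mul hg.1.aemeasurable.sqrt).aestronglyMeasurable)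
    (.of_forall fun p => ?_)
  rw [Real.norm_of_nonneg (by positivity), Pi.add_apply]
  nlinarith [Real.sq_sqrt (hf0 p), Real.sq_sqrt (hg0 p), sq_nonneg (√(f p) - √(g p)), hf0 p, hg0 p]

/-- Fubini's theorem for the product of two mixtures with the same mixing measure. -/
lemma integral_mixture_mul_mixture {Z R : Type*} [MeasurableSpace Z] [MeasurableSpace R]
    {ν : Measure Z} [SFinite ν] {τ : Measure R} [SFinite τ] {u v : Z → R → ℝ}
    (hu : Measurable fun q : Z × R => u q.1 q.2) (hv : Measurable fun q : Z × R => v q.1 q.2)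
    (hui : ∀ z, Integrable (u z) τ) (hvi : ∀ z, Integrable (v z) τ) {g : Z → ℝ}
    (hg : Integrable g ν) (hb : ∀ z, (∫ r, |u z r| ∂τ) * (∫ r, |v z r| ∂τ) ≤ g z) :
    Integrable (fun q : R × R => ∫ z, u z q.1 * v z q.2 ∂ν) (τ.prod τ) ∧
      ∫ q : R × R, ∫ z, u z q.1 * v z q.2 ∂ν ∂τ.prod τ
        = ∫ z, (∫ r, u z r ∂τ) * (∫ r, v z r ∂τ) ∂ν := by
  have hm : Measurable (fun q : Z × (R × R) => u q.1 q.2.1 * v q.1 q.2.2) :=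
    (hu.comp (measurable_fst.prodMk (measurable_fst.comp measurable_snd))).mul
      (hv.comp (measurable_fst.prodMk (measurable_snd.comp measurable_snd)))
  have hi : Integrable (fun q : Z × (R × R) => u q.1 q.2.1 * v q.1 q.2.2) (ν.prod (τ.prod τ)) := by
    rw [integrable_prod_iff hm.aestronglyMeasurable]
    refine ⟨.of_forall fun z => (hui z).mul_prod (hvi z), ?_⟩
    refine hg.mono' hm.aestronglyMeasurable.norm.integral_prod_right' (.of_forall fun z => ?_)
    refine le_trans (le_of_eq ?_) (hb z)
    simp only [norm_mul, Real.norm_eq_abs]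
    rw [integral_prod_mul (fun r => |u z r|) (fun r => |v z r|), abs_mul,
      abs_of_nonneg (integral_nonneg fun _ => abs_nonneg _),
      abs_of_nonneg (integral_nonneg fun _ => abs_nonneg _)]
  refine ⟨hi.integral_prod_right, ?_⟩
  rw [← integral_integral_swap (f := fun z (q : R × R) => u z q.1 * v z q.2) hi]
  exact integral_congr_ae (.of_forall fun z => integral_prod_mul _ _)

/-- The distance covariance of two powers of distances is a mixture of Hilbert–Schmidt criteria. -/
theorem integral_hsic_scaledKernel {β : ℝ} (hβ : 0 < β) (hβ' : β < 2)
    (μ : Measure (H × K)) [IsProbabilityMeasure μ]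
    (hX : Integrable (fun p : (H × K) × (H × K) => distKernel β p.1.1 p.2.1) (μ.prod μ))
    (hY : Integrable (fun p : (H × K) × (H × K) => distKernel β p.1.2 p.2.2) (μ.prod μ)) :
    Integrable (fun q : ℝ × ℝ => hsic (scaledKernel q.1) (scaledKernel q.2) μ)
        ((powMeasure β).prod (powMeasure β)) ∧
    ∫ q : ℝ × ℝ, hsic (scaledKernel q.1) (scaledKernel q.2) μ ∂(powMeasure β).prod (powMeasure β)
      = powConst β ^ 2 * hsic (distKernel β) (distKernel β) μ := by
  -- The majorant is a function of the diagonal formed by pairs 0 and 2 times the same function of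
  -- the diagonal formed by pairs 1 and 3. These are independent, so integrability on one diagonal
  -- is enough.
  have hh := integrable_sqrt_mul_sqrt hX hY (fun _ => distKernel_nonneg _ _ _)
    (fun _ => distKernel_nonneg _ _ _)
  have hC := (powConst_pos hβ hβ').le
  obtain ⟨hi, he⟩ := integral_mixture_mul_mixture
    (ν := (μ.prod μ).prod (μ.prod μ)) (τ := powMeasure β)
    (u := fun z r => quad (scaledKernel r) z.1.1.1 z.2.1.1 z.1.2.1 z.2.2.1)
    (v := fun z r => quad (scaledKernel r) z.1.1.2 z.2.1.2 z.1.2.2 z.2.2.2)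
    (measurable_quad_scaledKernel (by fun_prop) (by fun_prop) (by fun_prop) (by fun_prop)
      (by fun_prop))
    (measurable_quad_scaledKernel (by fun_prop) (by fun_prop) (by fun_prop) (by fun_prop)
      (by fun_prop))
    (fun z => integrable_quad_scaledKernel hβ hβ' _ _ _ _)
    (fun z => integrable_quad_scaledKernel hβ hβ' _ _ _ _)
    ((hh.mul_prod hh).const_mul ((powConst β * 2) * (powConst β * 2)))
    (fun z => (mul_le_mul (integral_abs_quad_scaledKernel_le hβ hβ' _ _ _ _)
      (integral_abs_quad_scaledKernel_le hβ hβ' _ _ _ _) (integral_nonneg fun _ => abs_nonneg _)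
      (by positivity)).trans (le_of_eq (by ring)))
  refine ⟨hi, he.trans ?_⟩
  rw [hsic, ← integral_const_mul]
  refine integral_congr_ae (.of_forall fun z => ?_)
  simp only [integral_quad_scaledKernel hβ hβ']
  ring

/-- A mixture of nonnegative terms vanishes only if almost all terms do, and a single pair of
positive scales already gives independence. -/
theorem hsic_distKernel_eq_zero_iff {β : ℝ} (hβ : 0 < β) (hβ' : β < 2)
    (μ : Measure (H × K)) [IsProbabilityMeasure μ]
    (hX : Integrable (fun p : (H × K) × (H × K) => distKernel β p.1.1 p.2.1) (μ.prod μ))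
    (hY : Integrable (fun p : (H × K) × (H × K) => distKernel β p.1.2 p.2.2) (μ.prod μ)) :
    hsic (distKernel β) (distKernel β) μ = 0 ↔ μ = μ.fst.prod μ.snd := by
  obtain ⟨hi, he⟩ := integral_hsic_scaledKernel hβ hβ' μ hX hY
  have hC := powConst_pos hβ hβ'
  have : hsic (distKernel β) (distKernel β) μ = 0 ↔
      ∫ q : ℝ × ℝ, hsic (scaledKernel q.1) (scaledKernel q.2) μ
        ∂(powMeasure β).prod (powMeasure β) = 0 := by
    rw [he]; simp [hC.ne']
  have hnn : 0 ≤ fun q : ℝ × ℝ => hsic (scaledKernel (H := H) q.1) (scaledKernel (H := K) q.2) μ :=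
    fun q => hsic_scaledKernel_nonneg q.1 q.2 μ
  rw [this, integral_eq_zero_iff_of_nonneg hnn hi]
  constructor
  · intro h0
    have := neBot_ae_powMeasure hβ hβ'
    have : (ae ((powMeasure β).prod (powMeasure β))).NeBot := by
      rw [ae_neBot, ← Measure.measure_univ_ne_zero, ← Set.univ_prod_univ, Measure.prod_prod]
      exact mul_ne_zero (by simpa) (by simpa)
    obtain ⟨q, hq, h1, h2⟩ := (h0.and
      ((Measure.quasiMeasurePreserving_fst.ae (ae_pos_powMeasure β)).and
        (Measure.quasiMeasurePreserving_snd.ae (ae_pos_powMeasure β)))).exists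
    exact eq_prod_of_hsic_scaledKernel_eq_zero h1.ne' h2.ne' μ hq
  · intro h
    refine .of_forall fun q => ?_
    have := hsic_scaledKernel_prod q.1 q.2 μ.fst μ.snd
    rwa [← h] at this

end Fubini

/-! ### Four independent copies -/

section Copies

variable {E Ω : Type*} [MeasurableSpace E] [MeasurableSpace Ω] {P : Measure Ω}
  [IsProbabilityMeasure P] {μ : Measure E} {Z : Fin 4 → Ω → E}

lemma map_pair_eq (hZ : ∀ i, Measurable (Z i)) (hi : iIndepFun Z P) (hl : ∀ i, P.map (Z i) = μ)
    {i j : Fin 4} (hij : i ≠ j) : P.map (fun ω => (Z i ω, Z j ω)) = μ.prod μ := by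
  rw [(indepFun_iff_map_prod_eq_prod_map_map (hZ i).aemeasurable (hZ j).aemeasurable).1
    (hi.indepFun hij), hl, hl]

lemma map_triple_eq (hZ : ∀ i, Measurable (Z i)) (hi : iIndepFun Z P)
    (hl : ∀ i, P.map (Z i) = μ) :
    P.map (fun ω => (Z 0 ω, Z 1 ω, Z 2 ω)) = μ.prod (μ.prod μ) := by
  have h : IndepFun (Z 0) (fun ω => (Z 1 ω, Z 2 ω)) P :=
    (hi.indepFun_prodMk hZ 1 2 0 (by decide) (by decide)).symm
  rw [(indepFun_iff_map_prod_eq_prod_map_map (hZ 0).aemeasurable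
    ((hZ 1).prodMk (hZ 2)).aemeasurable).1 h, hl, map_pair_eq hZ hi hl (by decide)]

/-- The copies are grouped by diagonals, in the arrangement used by `hsic`. -/
lemma map_quadruple_eq (hZ : ∀ i, Measurable (Z i)) (hi : iIndepFun Z P)
    (hl : ∀ i, P.map (Z i) = μ) :
    P.map (fun ω => ((Z 0 ω, Z 2 ω), (Z 1 ω, Z 3 ω))) = (μ.prod μ).prod (μ.prod μ) := by
  have h := hi.indepFun_prodMk_prodMk hZ 0 2 1 3 (by decide) (by decide) (by decide) (by decide)
  rw [(indepFun_iff_map_prod_eq_prod_map_map ((hZ 0).prodMk (hZ 2)).aemeasurable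
    ((hZ 1).prodMk (hZ 3)).aemeasurable).1 h, map_pair_eq hZ hi hl (by decide),
    map_pair_eq hZ hi hl (by decide)]

lemma identDistrib_perm (hZ : ∀ i, Measurable (Z i)) (hi : iIndepFun Z P)
    (hl : ∀ i, P.map (Z i) = μ) (σ : Equiv.Perm (Fin 4)) :
    IdentDistrib (fun ω i => Z (σ i) ω) (fun ω i => Z i ω) P P := by
  refine ⟨(measurable_pi_lambda _ fun i => hZ _).aemeasurable,
    (measurable_pi_lambda _ fun i => hZ _).aemeasurable, ?_⟩
  rw [(iIndepFun_iff_map_fun_eq_pi_map fun i => (hZ i).aemeasurable).1 hi,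
    (iIndepFun_iff_map_fun_eq_pi_map fun i => (hZ (σ i)).aemeasurable).1
      (hi.precomp σ.injective)]
  simp only [hl]

/-- Exchangeability of the copies makes the four edges of `quad a` contribute equally. One edge,
multiplied by `quad b`, meets itself once, an adjacent edge twice with a negative sign, and the
opposite edge once; the last term factors by independence. -/
lemma integral_quad_mul_quad (hZ : ∀ i, Measurable (Z i)) (hi : iIndepFun Z P)
    (hl : ∀ i, P.map (Z i) = μ) {a b : E → E → ℝ}
    (ha : Measurable fun p : E × E => a p.1 p.2) (hb : Measurable fun p : E × E => b p.1 p.2)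
    (ha' : ∀ x y, a x y = a y x) (hb' : ∀ x y, b x y = b y x)
    (ia : Integrable (fun ω => a (Z 0 ω) (Z 1 ω)) P)
    (ib : Integrable (fun ω => b (Z 0 ω) (Z 1 ω)) P)
    (iab : Integrable (fun ω => a (Z 0 ω) (Z 1 ω) * b (Z 0 ω) (Z 1 ω)) P)
    (iab' : Integrable (fun ω => a (Z 0 ω) (Z 1 ω) * b (Z 0 ω) (Z 2 ω)) P) :
    ∫ ω, quad a (Z 0 ω) (Z 1 ω) (Z 2 ω) (Z 3 ω) * quad b (Z 0 ω) (Z 1 ω) (Z 2 ω) (Z 3 ω) ∂P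
      = 4 * (∫ ω, a (Z 0 ω) (Z 1 ω) * b (Z 0 ω) (Z 1 ω) ∂P
        + (∫ ω, a (Z 0 ω) (Z 1 ω) ∂P) * (∫ ω, b (Z 0 ω) (Z 1 ω) ∂P)
        - 2 * ∫ ω, a (Z 0 ω) (Z 1 ω) * b (Z 0 ω) (Z 2 ω) ∂P) := by
  have ma (i j : Fin 4) : Measurable fun z : Fin 4 → E => a (z i) (z j) :=
    ha.comp (f := fun z : Fin 4 → E => (z i, z j)) (by fun_prop)
  have mb (i j : Fin 4) : Measurable fun z : Fin 4 → E => b (z i) (z j) :=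
    hb.comp (f := fun z : Fin 4 → E => (z i, z j)) (by fun_prop)
  -- terms with a common vertex
  have common (σ : Equiv.Perm (Fin 4)) :
      Integrable (fun ω => a (Z (σ 0) ω) (Z (σ 1) ω) * b (Z (σ 0) ω) (Z (σ 2) ω)) P ∧
      ∫ ω, a (Z (σ 0) ω) (Z (σ 1) ω) * b (Z (σ 0) ω) (Z (σ 2) ω) ∂P
        = ∫ ω, a (Z 0 ω) (Z 1 ω) * b (Z 0 ω) (Z 2 ω) ∂P := by
    have := (identDistrib_perm hZ hi hl σ).comp ((ma 0 1).mul (mb 0 2))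
    exact ⟨this.integrable_iff.2 iab', this.integral_eq⟩
  -- These permutations give the two adjacent edges: `{1, 2}`, sharing vertex 1 with `{0, 1}`, and
  -- `{0, 3}`, sharing vertex 0.
  have h2 := common (Equiv.swap 0 1)
  have h4 := common (Equiv.swap 2 3)
  have e2 : (Equiv.swap (0 : Fin 4) 1) 0 = 1 ∧ (Equiv.swap (0 : Fin 4) 1) 1 = 0
    ∧ (Equiv.swap (0 : Fin 4) 1) 2 = 2 := by decide
  have e4 : (Equiv.swap (2 : Fin 4) 3) 0 = 0 ∧ (Equiv.swap (2 : Fin 4) 3) 1 = 1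
    ∧ (Equiv.swap (2 : Fin 4) 3) 2 = 3 := by decide
  rw [e2.1, e2.2.1, e2.2.2] at h2
  rw [e4.1, e4.2.1, e4.2.2] at h4
  -- opposite edges
  have hind : IndepFun (fun ω => a (Z 0 ω) (Z 1 ω)) (fun ω => b (Z 2 ω) (Z 3 ω)) P :=
    (hi.indepFun_prodMk_prodMk hZ 0 1 2 3 (by decide) (by decide) (by decide) (by decide)).comp
      ha hb
  have eb : IdentDistrib (fun ω => b (Z 2 ω) (Z 3 ω)) (fun ω => b (Z 0 ω) (Z 1 ω)) P P := by
    exact (identDistrib_perm hZ hi hl (Equiv.addRight 2)).comp (mb 0 1)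
  have h3 : Integrable (fun ω => a (Z 0 ω) (Z 1 ω) * b (Z 2 ω) (Z 3 ω)) P ∧
      ∫ ω, a (Z 0 ω) (Z 1 ω) * b (Z 2 ω) (Z 3 ω) ∂P
        = (∫ ω, a (Z 0 ω) (Z 1 ω) ∂P) * (∫ ω, b (Z 0 ω) (Z 1 ω) ∂P) :=
    ⟨hind.integrable_mul ia (eb.integrable_iff.2 ib), by
      rw [← eb.integral_eq]
      exact hind.integral_fun_mul_eq_mul_integral ia.1 (eb.integrable_iff.2 ib).1⟩
  -- one edge against the quadrilateral
  set G : (Fin 4 → E) → ℝ := fun z => a (z 0) (z 1) * quad b (z 0) (z 1) (z 2) (z 3) with hG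
  have mG : Measurable G :=
    (ma 0 1).mul ((((mb 0 1).sub (mb 1 2)).add (mb 2 3)).sub (mb 3 0))
  have eG : (fun ω => G fun i => Z i ω) = fun ω => a (Z 0 ω) (Z 1 ω) * b (Z 0 ω) (Z 1 ω)
      - a (Z 1 ω) (Z 0 ω) * b (Z 1 ω) (Z 2 ω) + a (Z 0 ω) (Z 1 ω) * b (Z 2 ω) (Z 3 ω)
      - a (Z 0 ω) (Z 1 ω) * b (Z 0 ω) (Z 3 ω) := by
    funext ω
    simp only [hG, quad, ha' (Z 1 ω) (Z 0 ω), hb' (Z 0 ω) (Z 3 ω)]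
    ring
  have iG : Integrable (fun ω => G fun i => Z i ω) P := by
    rw [eG]
    exact ((iab.sub h2.1).add h3.1).sub h4.1
  have vG : ∫ ω, G (fun i => Z i ω) ∂P = ∫ ω, a (Z 0 ω) (Z 1 ω) * b (Z 0 ω) (Z 1 ω) ∂P
        + (∫ ω, a (Z 0 ω) (Z 1 ω) ∂P) * (∫ ω, b (Z 0 ω) (Z 1 ω) ∂P)
        - 2 * ∫ ω, a (Z 0 ω) (Z 1 ω) * b (Z 0 ω) (Z 2 ω) ∂P := by
    rw [eG]
    refine ((integral_sub ((iab.sub h2.1).add h3.1) h4.1).trans (congrArg₂ _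
      ((integral_add (iab.sub h2.1) h3.1).trans (congrArg₂ _ (integral_sub iab h2.1) h3.2))
      h4.2)).trans ?_
    rw [h2.2]
    ring
  -- rotation of the quadrilateral
  have rot (σ : Equiv.Perm (Fin 4)) : Integrable (fun ω => G fun i => Z (σ i) ω) P ∧
      ∫ ω, G (fun i => Z (σ i) ω) ∂P = ∫ ω, G (fun i => Z i ω) ∂P := by
    have := (identDistrib_perm hZ hi hl σ).comp mG
    exact ⟨this.integrable_iff.2 iG, this.integral_eq⟩
  -- A rotation by one vertex changes the sign of `quad b`, which matches the alternating signs of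
  -- the edges in `quad a`.
  have es (k : Fin 4) : Integrable (fun ω => G fun i => Z (i + k) ω) P ∧
      ∫ ω, G (fun i => Z (i + k) ω) ∂P = ∫ ω, G (fun i => Z i ω) ∂P := rot (Equiv.addRight k)
  have e : (fun ω => quad a (Z 0 ω) (Z 1 ω) (Z 2 ω) (Z 3 ω)
      * quad b (Z 0 ω) (Z 1 ω) (Z 2 ω) (Z 3 ω)) = fun ω => G (fun i => Z (i + 0) ω)
        + G (fun i => Z (i + 1) ω) + G (fun i => Z (i + 2) ω) + G (fun i => Z (i + 3) ω) := by
    funext ω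
    have e12 : (1 : Fin 4) + 1 = 2 := rfl
    have e13 : (2 : Fin 4) + 1 = 3 := rfl
    have e14 : (3 : Fin 4) + 1 = 0 := rfl
    have e21 : (1 : Fin 4) + 2 = 3 := rfl
    have e22 : (2 : Fin 4) + 2 = 0 := rfl
    have e23 : (3 : Fin 4) + 2 = 1 := rfl
    have e31 : (1 : Fin 4) + 3 = 0 := rfl
    have e32 : (2 : Fin 4) + 3 = 1 := rfl
    have e33 : (3 : Fin 4) + 3 = 2 := rfl
    simp only [hG, quad, add_zero, zero_add, e12, e13, e14, e21, e22, e23, e31, e32, e33]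
    ring
  rw [e]
  refine ((integral_add (((es 0).1.add (es 1).1).add (es 2).1) (es 3).1).trans (congrArg₂ _
    ((integral_add ((es 0).1.add (es 1).1) (es 2).1).trans (congrArg₂ _
      (integral_add (es 0).1 (es 1).1) rfl)) rfl)).trans ?_
  rw [(es 0).2, (es 1).2, (es 2).2, (es 3).2, vG]
  ring

end Copies

/-- The conditional expectation of a function of two independent variables. -/
lemma condExp_prod_of_indepFun {Ω α γ F : Type*} [MeasurableSpace Ω] [MeasurableSpace α]
    [MeasurableSpace γ] [StandardBorelSpace γ] [Nonempty γ] [NormedAddCommGroup F]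
    [NormedSpace ℝ F] [CompleteSpace F] {P : Measure Ω} [IsProbabilityMeasure P] {U : Ω → α}
    {V : Ω → γ} (hU : Measurable U) (hV : Measurable V) (h : IndepFun U V P) {f : α × γ → F}
    (hf : StronglyMeasurable f) (hi : Integrable (fun ω => f (U ω, V ω)) P) :
    P[fun ω => f (U ω, V ω) | MeasurableSpace.comap U inferInstance]
      =ᵐ[P] fun ω => ∫ v, f (U ω, v) ∂(P.map V) := by
  have := Measure.isProbabilityMeasure_map (μ := P) hV.aemeasurable
  refine (condExp_prod_ae_eq_integral_condDistrib hU hV.aemeasurable hf hi).trans ?_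
  -- By independence the conditional law of `V` given `U` is the constant kernel.
  have hc : condDistrib V U P =ᵐ[P.map U] Kernel.const α (P.map V) := by
    refine condDistrib_ae_eq_of_measure_eq_compProd _ hV.aemeasurable ?_
    rw [Measure.compProd_const]
    exact (indepFun_iff_map_prod_eq_prod_map_map hU.aemeasurable hV.aemeasurable).1 h
  filter_upwards [ae_of_ae_map hU.aemeasurable hc] with ω hω
  rw [hω, Kernel.const_apply]

/-! ### Moments of distances -/

lemma distKernel_le {H : Type*} [NormedAddCommGroup H] {β : ℝ} (hβ : 0 < β) (x y : H) :
    distKernel β x y ≤ 2 ^ β * (‖x‖ ^ β + ‖y‖ ^ β) := by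
  have h1 : dist x y ≤ 2 * max ‖x‖ ‖y‖ := by
    rw [dist_eq_norm]
    linarith [norm_sub_le x y, le_max_left ‖x‖ ‖y‖, le_max_right ‖x‖ ‖y‖]
  have h2 : (max ‖x‖ ‖y‖) ^ β ≤ ‖x‖ ^ β + ‖y‖ ^ β := by
    have hx := Real.rpow_nonneg (norm_nonneg x) β
    have hy := Real.rpow_nonneg (norm_nonneg y) β
    rcases max_choice ‖x‖ ‖y‖ with h | h <;> rw [h] <;> linarith
  calc distKernel β x y ≤ (2 * max ‖x‖ ‖y‖) ^ β := Real.rpow_le_rpow dist_nonneg h1 hβ.le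
    _ = 2 ^ β * (max ‖x‖ ‖y‖) ^ β := Real.mul_rpow zero_le_two (by positivity)
    _ ≤ _ := mul_le_mul_of_nonneg_left h2 (by positivity)

section Moments

variable {H Ω : Type*} [NormedAddCommGroup H] [TopologicalSpace.SeparableSpace H]
  [MeasurableSpace H] [BorelSpace H] [MeasurableSpace Ω] {P : Measure Ω} {β : ℝ}

lemma integrable_distKernel (hβ : 0 < β) {U V : Ω → H} (hU : Measurable U) (hV : Measurable V)
    (iU : Integrable (fun ω => ‖U ω‖ ^ β) P) (iV : Integrable (fun ω => ‖V ω‖ ^ β) P) :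
    Integrable (fun ω => distKernel β (U ω) (V ω)) P :=
  ((iU.add iV).const_mul (2 ^ β)).mono' (measurable_distKernel β hU hV).aestronglyMeasurable
    (.of_forall fun ω => by
      rw [Real.norm_of_nonneg (distKernel_nonneg _ _ _)]
      exact distKernel_le hβ _ _)

lemma memLp_two_distKernel (hβ : 0 < β) {U V : Ω → H} (hU : Measurable U) (hV : Measurable V)
    (iU : Integrable (fun ω => ‖U ω‖ ^ (2 * β)) P) (iV : Integrable (fun ω => ‖V ω‖ ^ (2 * β)) P) :
    MemLp (fun ω => distKernel β (U ω) (V ω)) 2 P := by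
  rw [memLp_two_iff_integrable_sq (measurable_distKernel β hU hV).aestronglyMeasurable]
  convert integrable_distKernel (mul_pos two_pos hβ) hU hV iU iV using 2 with ω
  rw [distKernel, distKernel, mul_comm, Real.rpow_mul dist_nonneg, Real.rpow_two]

end Moments

/-! ### Centred distances -/

section Centred

variable {H : Type*} [MeasurableSpace H]

/-- The mean of `quad a x y`, if the last two vertices are independent with law `ν`. -/
def centredKernel (a : H → H → ℝ) (ν : Measure H) (x y : H) : ℝ :=
  ∫ w, quad a x y w.1 w.2 ∂ν.prod ν

variable {a : H → H → ℝ} {ν : Measure H} [IsProbabilityMeasure ν]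

lemma centredKernel_eq (hs : ∀ x y, a x y = a y x) (h1 : ∀ x, Integrable (a x) ν)
    (h2 : Integrable (fun p : H × H => a p.1 p.2) (ν.prod ν)) (x y : H) :
    centredKernel a ν x y
      = a x y - ∫ u, a y u ∂ν + ∫ p : H × H, a p.1 p.2 ∂ν.prod ν - ∫ u, a x u ∂ν := by
  have i1 : Integrable (fun w : H × H => a y w.1) (ν.prod ν) := (h1 y).comp_fst ν
  have i2 : Integrable (fun w : H × H => a w.2 x) (ν.prod ν) := by
    simp only [hs _ x]; exact (h1 x).comp_snd ν
  have i0 : Integrable (fun _ : H × H => a x y) (ν.prod ν) := integrable_const _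
  refine (integral_sub ((i0.sub i1).add h2) i2).trans ((congrArg₂ _
    ((integral_add (i0.sub i1) h2).trans (congrArg₂ _ (integral_sub i0 i1) rfl)) rfl).trans ?_)
  simp only [hs _ x]
  rw [integral_fun_fst (fun u => a y u), integral_fun_snd (fun u => a x u)]
  simp

lemma centredKernel_comm (hs : ∀ x y, a x y = a y x) (h1 : ∀ x, Integrable (a x) ν)
    (h2 : Integrable (fun p : H × H => a p.1 p.2) (ν.prod ν)) (x y : H) :
    centredKernel a ν x y = centredKernel a ν y x := by
  rw [centredKernel_eq hs h1 h2, centredKernel_eq hs h1 h2, hs x y]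
  ring

/-- The corrections are a constant and functions of one vertex; every vertex lies on two edges of
opposite sign, so all of them cancel. -/
lemma quad_centredKernel (hs : ∀ x y, a x y = a y x) (h1 : ∀ x, Integrable (a x) ν)
    (h2 : Integrable (fun p : H × H => a p.1 p.2) (ν.prod ν)) :
    quad (centredKernel a ν) = quad a := by
  funext x₀ x₁ x₂ x₃
  simp only [quad, centredKernel_eq hs h1 h2]
  ring

lemma integral_centredKernel (hs : ∀ x y, a x y = a y x) (h1 : ∀ x, Integrable (a x) ν)
    (h2 : Integrable (fun p : H × H => a p.1 p.2) (ν.prod ν)) (x : H) :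
    ∫ y, centredKernel a ν x y ∂ν = 0 := by
  simp only [centredKernel_eq hs h1 h2]
  have hm : Integrable (fun y => ∫ u, a y u ∂ν) ν := h2.integral_prod_left
  have c1 : Integrable (fun _ : H => ∫ p : H × H, a p.1 p.2 ∂ν.prod ν) ν := integrable_const _
  have c2 : Integrable (fun _ : H => ∫ u, a x u ∂ν) ν := integrable_const _
  refine (integral_sub (((h1 x).sub hm).add c1) c2).trans ((congrArg₂ _
    ((integral_add ((h1 x).sub hm) c1).trans (congrArg₂ _ (integral_sub (h1 x) hm) rfl))
    rfl).trans ?_)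
  rw [integral_prod _ h2]
  simp

lemma measurable_centredKernel {T : Type*} [MeasurableSpace T]
    (ha : Measurable fun p : H × H => a p.1 p.2) {x y : T → H} (hx : Measurable x)
    (hy : Measurable y) : Measurable fun t => centredKernel a ν (x t) (y t) := by
  have ha' {f g : T × (H × H) → H} (hf : Measurable f) (hg : Measurable g) :
      Measurable fun t => a (f t) (g t) := ha.comp (hf.prodMk hg)
  have : Measurable fun q : T × (H × H) => quad a (x q.1) (y q.1) q.2.1 q.2.2 := by
    simp only [quad]
    exact (((ha' (by fun_prop) (by fun_prop)).sub (ha' (by fun_prop) (by fun_prop))).add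
      (ha' (by fun_prop) (by fun_prop))).sub (ha' (by fun_prop) (by fun_prop))
  exact this.stronglyMeasurable.integral_prod_right'.measurable

end Centred

/-- The four-point inequality is averaged over the last two vertices, again with a parameter `t`
that is optimized only after integration. The product form of the bound makes products of centred
kernels integrable under moments of order `β`. -/
lemma abs_centredKernel_distKernel_le {H : Type*}
    [NormedAddCommGroup H] [InnerProductSpace ℝ H] [CompleteSpace H]
    [TopologicalSpace.SeparableSpace H] [MeasurableSpace H] [BorelSpace H] {β : ℝ} (hβ : 0 < β)
    (hβ' : β < 2) {ν : Measure H} [IsProbabilityMeasure ν]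
    (h1 : ∀ x, Integrable (distKernel β x) ν) (x y : H) :
    |centredKernel (distKernel β) ν x y|
      ≤ 2 * (√(∫ u, distKernel β x u ∂ν) * √(∫ u, distKernel β y u ∂ν)) := by
  refine le_two_mul_sqrt_of_forall_le (integral_nonneg fun _ => distKernel_nonneg _ _ _)
    (integral_nonneg fun _ => distKernel_nonneg _ _ _) fun t ht => ?_
  have i1 : Integrable (fun w : H × H => t * distKernel β x w.1) (ν.prod ν) :=
    ((h1 x).comp_fst ν).const_mul t
  have i2 : Integrable (fun w : H × H => t⁻¹ * distKernel β y w.2) (ν.prod ν) :=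
    ((h1 y).comp_snd ν).const_mul t⁻¹
  calc |centredKernel (distKernel β) ν x y|
      ≤ ∫ w : H × H, (t * distKernel β x w.1 + t⁻¹ * distKernel β y w.2) ∂ν.prod ν := by
        rw [centredKernel, ← Real.norm_eq_abs]
        refine norm_integral_le_of_norm_le (i1.add i2) (.of_forall fun w => ?_)
        refine (abs_quad_distKernel_le hβ hβ' x y w.1 w.2).trans ?_
        have e1 := Real.sq_sqrt (distKernel_nonneg β x w.1)
        have e2 := Real.sq_sqrt (distKernel_nonneg β y w.2)
        have h : 0 ≤ t⁻¹ * (t * √(distKernel β x w.1) - √(distKernel β y w.2)) ^ 2 := by positivity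
        have h' : t⁻¹ * (t * √(distKernel β x w.1) - √(distKernel β y w.2)) ^ 2
            = t * √(distKernel β x w.1) ^ 2 + t⁻¹ * √(distKernel β y w.2) ^ 2
              - 2 * (√(distKernel β x w.1) * √(distKernel β y w.2)) := by
          field_simp
          ring
        rw [e1, e2] at h'
        linarith
    _ = _ := by
        rw [integral_add i1 i2, integral_const_mul, integral_const_mul,
          integral_fun_fst (fun u => distKernel β x u),
          integral_fun_snd (fun u => distKernel β y u)]
        simp

/-! ### The definitions by means of independent copies -/

lemma indepFun_iff_map_eq_prod_fst_snd {Ω α γ : Type*} [MeasurableSpace Ω] [MeasurableSpace α]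
    [MeasurableSpace γ] {P : Measure Ω} [IsProbabilityMeasure P] {X : Ω → α} {Y : Ω → γ}
    (hX : Measurable X) (hY : Measurable Y) : IndepFun X Y P ↔
      P.map (fun ω => (X ω, Y ω))
        = (P.map fun ω => (X ω, Y ω)).fst.prod (P.map fun ω => (X ω, Y ω)).snd := by
  rw [indepFun_iff_map_prod_eq_prod_map_map hX.aemeasurable hY.aemeasurable,
    Measure.fst_map_prodMk hY, Measure.snd_map_prodMk hX]

section Copies

variable {H K Ω Ω' : Type*}
    [NormedAddCommGroup H] [InnerProductSpace ℝ H] [CompleteSpace H]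
    [TopologicalSpace.SeparableSpace H] [MeasurableSpace H] [BorelSpace H]
    [NormedAddCommGroup K] [InnerProductSpace ℝ K] [CompleteSpace K]
    [TopologicalSpace.SeparableSpace K] [MeasurableSpace K] [BorelSpace K]
    [MeasurableSpace Ω] {P : Measure Ω} [MeasurableSpace Ω'] {P' : Measure Ω'}
    {β : ℝ} {X : Ω → H} {Y : Ω → K} {Xs : Fin 4 → Ω' → H} {Ys : Fin 4 → Ω' → K}

namespace IsIndepCopies

lemma measurable (h : IsIndepCopies P X Y P' Xs Ys) (i : Fin 4) :
    Measurable fun ω => (Xs i ω, Ys i ω) := (h.measurable_left i).prodMk (h.measurable_right i)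

lemma norm_rpow_left (h : IsIndepCopies P X Y P' Xs Ys)
    (hX : Integrable (fun ω => ‖X ω‖ ^ β) P) (i : Fin 4) :
    Integrable (fun ω => ‖Xs i ω‖ ^ β) P' :=
  ((h.identDistrib i).comp (u := fun z : H × K => ‖z.1‖ ^ β)
    (measurable_fst.norm.pow_const β)).integrable_iff.2 hX

lemma norm_rpow_right (h : IsIndepCopies P X Y P' Xs Ys)
    (hY : Integrable (fun ω => ‖Y ω‖ ^ β) P) (i : Fin 4) :
    Integrable (fun ω => ‖Ys i ω‖ ^ β) P' :=
  ((h.identDistrib i).comp (u := fun z : H × K => ‖z.2‖ ^ β)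
    (measurable_snd.norm.pow_const β)).integrable_iff.2 hY

variable [IsProbabilityMeasure P] [IsProbabilityMeasure P']

lemma integrable_left (h : IsIndepCopies P X Y P' Xs Ys)
    (i0 : Integrable (distPow β Xs 0 1) P') :
    Integrable (fun p : (H × K) × (H × K) => distKernel β p.1.1 p.2.1)
      ((P.map fun ω => (X ω, Y ω)).prod (P.map fun ω => (X ω, Y ω))) := by
  rw [← map_pair_eq h.measurable h.indep (fun i => (h.identDistrib i).map_eq)
    (by decide : (0 : Fin 4) ≠ 1), integrable_map_measure
    (measurable_distKernel β (by fun_prop) (by fun_prop)).aestronglyMeasurable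
    ((h.measurable 0).prodMk (h.measurable 1)).aemeasurable]
  exact i0

lemma integrable_right (h : IsIndepCopies P X Y P' Xs Ys)
    (i0 : Integrable (distPow β Ys 0 1) P') :
    Integrable (fun p : (H × K) × (H × K) => distKernel β p.1.2 p.2.2)
      ((P.map fun ω => (X ω, Y ω)).prod (P.map fun ω => (X ω, Y ω))) := by
  rw [← map_pair_eq h.measurable h.indep (fun i => (h.identDistrib i).map_eq)
    (by decide : (0 : Fin 4) ≠ 1), integrable_map_measure
    (measurable_distKernel β (by fun_prop) (by fun_prop)).aestronglyMeasurable
    ((h.measurable 0).prodMk (h.measurable 1)).aemeasurable]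
  exact i0

lemma integral_hatVar_mul_hatVar (h : IsIndepCopies P X Y P' Xs Ys) :
    ∫ ω, hatVar β Xs ω * hatVar β Ys ω ∂P'
      = hsic (distKernel β) (distKernel β) (P.map fun ω => (X ω, Y ω)) := by
  have m {f g : ((H × K) × (H × K)) × ((H × K) × (H × K)) → H} (hf : Measurable f)
    (hg : Measurable g) := measurable_distKernel β hf hg
  have m' {f g : ((H × K) × (H × K)) × ((H × K) × (H × K)) → K} (hf : Measurable f)
    (hg : Measurable g) := measurable_distKernel β hf hg
  rw [hsic, ← map_quadruple_eq h.measurable h.indep (fun i => (h.identDistrib i).map_eq),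
    integral_map (((h.measurable 0).prodMk (h.measurable 2)).prodMk
      ((h.measurable 1).prodMk (h.measurable 3))).aemeasurable]
  · rfl
  · refine Measurable.aestronglyMeasurable (Measurable.mul ?_ ?_) <;> simp only [quad]
    · exact (((m (by fun_prop) (by fun_prop)).sub (m (by fun_prop) (by fun_prop))).add
        (m (by fun_prop) (by fun_prop))).sub (m (by fun_prop) (by fun_prop))
    · exact (((m' (by fun_prop) (by fun_prop)).sub (m' (by fun_prop) (by fun_prop))).add
        (m' (by fun_prop) (by fun_prop))).sub (m' (by fun_prop) (by fun_prop))

lemma integrable_hatVar_mul_hatVar (hβ : 0 < β) (hβ' : β < 2)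
    (h : IsIndepCopies P X Y P' Xs Ys) (hX : Integrable (distPow β Xs 0 1) P')
    (hY : Integrable (distPow β Ys 0 1) P') :
    Integrable (fun ω => hatVar β Xs ω * hatVar β Ys ω) P' := by
  have hh := integrable_sqrt_mul_sqrt (h.integrable_left hX) (h.integrable_right hY)
    (fun _ => distKernel_nonneg _ _ _) (fun _ => distKernel_nonneg _ _ _)
  have hi := (hh.mul_prod hh).const_mul 4
  rw [← map_quadruple_eq h.measurable h.indep (fun i => (h.identDistrib i).map_eq)] at hi
  have hi' := hi.comp_measurable (((h.measurable 0).prodMk (h.measurable 2)).prodMk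
      ((h.measurable 1).prodMk (h.measurable 3)))
  have mX (i j : Fin 4) : Measurable (distPow β Xs i j) :=
    measurable_distKernel β (h.measurable_left i) (h.measurable_left j)
  have mY (i j : Fin 4) : Measurable (distPow β Ys i j) :=
    measurable_distKernel β (h.measurable_right i) (h.measurable_right j)
  refine hi'.mono' (((((mX 0 1).sub (mX 1 2)).add (mX 2 3)).sub (mX 3 0)).mul
    ((((mY 0 1).sub (mY 1 2)).add (mY 2 3)).sub (mY 3 0))).aestronglyMeasurable
    (.of_forall fun ω => ?_)
  rw [norm_mul]
  refine (mul_le_mul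
    (abs_quad_distKernel_le hβ hβ' (Xs 0 ω) (Xs 1 ω) (Xs 2 ω) (Xs 3 ω))
    (abs_quad_distKernel_le hβ hβ' (Ys 0 ω) (Ys 1 ω) (Ys 2 ω) (Ys 3 ω))
    (abs_nonneg _) (by positivity)).trans (le_of_eq ?_)
  simp only [Function.comp_apply]
  ring

lemma hsic_eq_zero_iff (hβ : 0 < β) (hβ' : β < 2) (mX : Measurable X) (mY : Measurable Y)
    (h : IsIndepCopies P X Y P' Xs Ys) (hX : Integrable (distPow β Xs 0 1) P')
    (hY : Integrable (distPow β Ys 0 1) P') :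
    hsic (distKernel β) (distKernel β) (P.map fun ω => (X ω, Y ω)) = 0 ↔ IndepFun X Y P := by
  have := Measure.isProbabilityMeasure_map (μ := P) (mX.prodMk mY).aemeasurable
  rw [indepFun_iff_map_eq_prod_fst_snd mX mY]
  exact hsic_distKernel_eq_zero_iff hβ hβ' _ (h.integrable_left hX) (h.integrable_right hY)

lemma integrable_distPow_left (hβ : 0 < β) (h : IsIndepCopies P X Y P' Xs Ys)
    (hX : Integrable (fun ω => ‖X ω‖ ^ β) P) (i j : Fin 4) :
    Integrable (distPow β Xs i j) P' :=
  integrable_distKernel hβ (h.measurable_left i) (h.measurable_left j) (h.norm_rpow_left hX i)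
    (h.norm_rpow_left hX j)

lemma integrable_distPow_right (hβ : 0 < β) (h : IsIndepCopies P X Y P' Xs Ys)
    (hY : Integrable (fun ω => ‖Y ω‖ ^ β) P) (i j : Fin 4) :
    Integrable (distPow β Ys i j) P' :=
  integrable_distKernel hβ (h.measurable_right i) (h.measurable_right j) (h.norm_rpow_right hY i)
    (h.norm_rpow_right hY j)

theorem dcovTwo (hβ : 0 < β) (hβ' : β < 2) (mX : Measurable X) (mY : Measurable Y)
    (h : IsIndepCopies P X Y P' Xs Ys) (hX : Integrable (fun ω => ‖X ω‖ ^ β) P)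
    (hY : Integrable (fun ω => ‖Y ω‖ ^ β) P) :
    DcovTwoFinite β P' Xs Ys ∧ (dcovTwo β P' Xs Ys = 0 ↔ IndepFun X Y P) := by
  have iX := h.integrable_distPow_left hβ hX 0 1
  have iY := h.integrable_distPow_right hβ hY 0 1
  refine ⟨h.integrable_hatVar_mul_hatVar hβ hβ' iX iY, ?_⟩
  rw [DistCov.dcovTwo, h.integral_hatVar_mul_hatVar, ← h.hsic_eq_zero_iff hβ hβ' mX mY iX iY]
  simp

theorem dcovOne (hβ : 0 < β) (hβ' : β < 2) (mX : Measurable X) (mY : Measurable Y)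
    (h : IsIndepCopies P X Y P' Xs Ys) (hX : Integrable (fun ω => ‖X ω‖ ^ (2 * β)) P)
    (hY : Integrable (fun ω => ‖Y ω‖ ^ (2 * β)) P) :
    DcovOneFinite β P' Xs Ys ∧ (dcovOne β P' Xs Ys = 0 ↔ IndepFun X Y P) := by
  have LX (i j : Fin 4) : MemLp (distPow β Xs i j) 2 P' :=
    memLp_two_distKernel hβ (h.measurable_left i) (h.measurable_left j) (h.norm_rpow_left hX i)
      (h.norm_rpow_left hX j)
  have LY (i j : Fin 4) : MemLp (distPow β Ys i j) 2 P' :=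
    memLp_two_distKernel hβ (h.measurable_right i) (h.measurable_right j)
      (h.norm_rpow_right hY i) (h.norm_rpow_right hY j)
  have iX := (LX 0 1).integrable one_le_two
  have iY := (LY 0 1).integrable one_le_two
  have iXY := (LX 0 1).integrable_mul (LY 0 1)
  have iXY' := (LX 0 1).integrable_mul (LY 0 2)
  refine ⟨⟨iXY, iX, iY, iXY'⟩, ?_⟩
  have key := integral_quad_mul_quad h.measurable h.indep (fun i => (h.identDistrib i).map_eq)
    (a := fun z z' => distKernel β z.1 z'.1) (b := fun z z' => distKernel β z.2 z'.2)
    (measurable_distKernel β (by fun_prop) (by fun_prop))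
    (measurable_distKernel β (by fun_prop) (by fun_prop)) (fun _ _ => distKernel_comm _ _ _)
    (fun _ _ => distKernel_comm _ _ _) iX iY iXY iXY'
  -- Moments of order `2 * β` make the expansion of the alternating sums legitimate term by term.
  have e : 4 * DistCov.dcovOne β P' Xs Ys
      = hsic (distKernel β) (distKernel β) (P.map fun ω => (X ω, Y ω)) :=
    key.symm.trans h.integral_hatVar_mul_hatVar
  rw [← h.hsic_eq_zero_iff hβ hβ' mX mY iX iY, ← e]
  simp

end IsIndepCopies

end Copies

/-! ### Kernels with zero marginal means, and the third definition -/

section Degenerate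

variable {E Ω : Type*} [MeasurableSpace E] [MeasurableSpace Ω] {P : Measure Ω}
  [IsProbabilityMeasure P] {μ : Measure E} [IsProbabilityMeasure μ] {Z : Fin 4 → Ω → E}

/-- In the expansion by edges, zero marginal means of `a` alone remove the product of the means and
the adjacent terms. The majorants need only `f` and `g` integrable, since each variable enters them
through `√f`, `√g` or `√f * √g`. -/
lemma integral_quad_mul_quad_of_degenerate (hZ : ∀ i, Measurable (Z i)) (hi : iIndepFun Z P)
    (hl : ∀ i, P.map (Z i) = μ) {a b : E → E → ℝ}
    (ha : Measurable fun p : E × E => a p.1 p.2) (hb : Measurable fun p : E × E => b p.1 p.2)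
    (ha' : ∀ x y, a x y = a y x) (hb' : ∀ x y, b x y = b y x)
    (ha0 : ∀ x, ∫ y, a x y ∂μ = 0)
    {f g : E → ℝ} (hf : Integrable f μ) (hg : Integrable g μ) (hf0 : ∀ x, 0 ≤ f x)
    (hg0 : ∀ x, 0 ≤ g x) (haf : ∀ x y, |a x y| ≤ 2 * (√(f x) * √(f y)))
    (hbg : ∀ x y, |b x y| ≤ 2 * (√(g x) * √(g y))) :
    Integrable (fun ω => a (Z 0 ω) (Z 1 ω) * b (Z 0 ω) (Z 1 ω)) P ∧
    ∫ ω, quad a (Z 0 ω) (Z 1 ω) (Z 2 ω) (Z 3 ω) * quad b (Z 0 ω) (Z 1 ω) (Z 2 ω) (Z 3 ω) ∂P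
      = 4 * ∫ ω, a (Z 0 ω) (Z 1 ω) * b (Z 0 ω) (Z 1 ω) ∂P := by
  have hone : Integrable (fun _ : E => (1 : ℝ)) μ := integrable_const _
  have sf : Integrable (fun x => √(f x)) μ := by
    simpa using integrable_sqrt_mul_sqrt hf hone hf0 fun _ => zero_le_one
  have sg : Integrable (fun x => √(g x)) μ := by
    simpa using integrable_sqrt_mul_sqrt hg hone hg0 fun _ => zero_le_one
  have sfg := integrable_sqrt_mul_sqrt hf hg hf0 hg0
  have m01 := (hZ 0).prodMk (hZ 1)
  have m012 := (hZ 0).prodMk ((hZ 1).prodMk (hZ 2))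
  have l01 := map_pair_eq hZ hi hl (by decide : (0 : Fin 4) ≠ 1)
  have l012 := map_triple_eq hZ hi hl
  have ia : Integrable (fun p : E × E => a p.1 p.2) (μ.prod μ) :=
    ((sf.mul_prod sf).const_mul 2).mono' ha.aestronglyMeasurable (.of_forall fun p => haf _ _)
  have ib : Integrable (fun p : E × E => b p.1 p.2) (μ.prod μ) :=
    ((sg.mul_prod sg).const_mul 2).mono' hb.aestronglyMeasurable (.of_forall fun p => hbg _ _)
  have iab : Integrable (fun p : E × E => a p.1 p.2 * b p.1 p.2) (μ.prod μ) := by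
    refine ((sfg.mul_prod sfg).const_mul 4).mono' (ha.mul hb).aestronglyMeasurable
      (.of_forall fun p => ?_)
    rw [norm_mul]
    exact (mul_le_mul (haf _ _) (hbg _ _) (abs_nonneg _) (by positivity)).trans
      (le_of_eq (by ring))
  have ma : Measurable fun p : E × E × E => a p.1 p.2.1 :=
    ha.comp (f := fun p : E × E × E => (p.1, p.2.1)) (by fun_prop)
  have mb : Measurable fun p : E × E × E => b p.1 p.2.2 :=
    hb.comp (f := fun p : E × E × E => (p.1, p.2.2)) (by fun_prop)
  have iab' : Integrable (fun p : E × E × E => a p.1 p.2.1 * b p.1 p.2.2) (μ.prod (μ.prod μ)) := by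
    refine ((sfg.mul_prod (sf.mul_prod sg)).const_mul 4).mono' (ma.mul mb).aestronglyMeasurable
      (.of_forall fun p => ?_)
    rw [norm_mul]
    exact (mul_le_mul (haf _ _) (hbg _ _) (abs_nonneg _) (by positivity)).trans
      (le_of_eq (by ring))
  have va : ∫ ω, a (Z 0 ω) (Z 1 ω) ∂P = 0 := by
    rw [← integral_map (f := fun p : E × E => a p.1 p.2) m01.aemeasurable ha.aestronglyMeasurable,
      l01, integral_prod _ ia]
    simp only [ha0, integral_zero]
  have vab : ∫ ω, a (Z 0 ω) (Z 1 ω) * b (Z 0 ω) (Z 2 ω) ∂P = 0 := by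
    rw [← integral_map (f := fun p : E × E × E => a p.1 p.2.1 * b p.1 p.2.2) m012.aemeasurable
      (ma.mul mb).aestronglyMeasurable, l012, integral_prod _ iab']
    simp only [integral_prod_mul, ha0, zero_mul, integral_zero]
  rw [← l01] at ia ib iab
  rw [← l012] at iab'
  have iab := iab.comp_measurable m01
  refine ⟨iab, ?_⟩
  rw [integral_quad_mul_quad hZ hi hl ha hb ha' hb' (ia.comp_measurable m01)
    (ib.comp_measurable m01) iab (iab'.comp_measurable m012), va, vab]
  ring

end Degenerate

section Tilde

variable {H Ω : Type*}
    [NormedAddCommGroup H] [InnerProductSpace ℝ H] [CompleteSpace H]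
    [TopologicalSpace.SeparableSpace H] [MeasurableSpace H] [BorelSpace H]
    [MeasurableSpace Ω] {P : Measure Ω} [IsProbabilityMeasure P] {ν : Measure H}
    {β : ℝ} {Z : Fin 4 → Ω → H}

lemma tildeVar_ae_eq (hZ : ∀ i, Measurable (Z i)) (hi : iIndepFun Z P)
    (hl : ∀ i, P.map (Z i) = ν) (hint : Integrable (hatVar β Z) P) :
    tildeVar β P Z =ᵐ[P] fun ω => centredKernel (distKernel β) ν (Z 0 ω) (Z 1 ω) := by
  have : SecondCountableTopology H := UniformSpace.secondCountable_of_separable H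
  have h := hi.indepFun_prodMk_prodMk hZ 0 1 2 3 (by decide) (by decide) (by decide) (by decide)
  have m {f g : (H × H) × (H × H) → H} (hf : Measurable f) (hg : Measurable g) :=
    measurable_distKernel β hf hg
  have hm : Measurable fun q : (H × H) × (H × H) => quad (distKernel β) q.1.1 q.1.2 q.2.1 q.2.2 :=
    (((m (by fun_prop) (by fun_prop)).sub (m (by fun_prop) (by fun_prop))).add
      (m (by fun_prop) (by fun_prop))).sub (m (by fun_prop) (by fun_prop))
  have := condExp_prod_of_indepFun ((hZ 0).prodMk (hZ 1)) ((hZ 2).prodMk (hZ 3)) h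
    hm.stronglyMeasurable hint
  rwa [map_pair_eq hZ hi hl (by decide)] at this

end Tilde

section Copies

variable {H K Ω Ω' : Type*}
    [NormedAddCommGroup H] [InnerProductSpace ℝ H] [CompleteSpace H]
    [TopologicalSpace.SeparableSpace H] [MeasurableSpace H] [BorelSpace H]
    [NormedAddCommGroup K] [InnerProductSpace ℝ K] [CompleteSpace K]
    [TopologicalSpace.SeparableSpace K] [MeasurableSpace K] [BorelSpace K]
    [MeasurableSpace Ω] {P : Measure Ω} [MeasurableSpace Ω'] {P' : Measure Ω'}
    {β : ℝ} {X : Ω → H} {Y : Ω → K} {Xs : Fin 4 → Ω' → H} {Ys : Fin 4 → Ω' → K}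
    [IsProbabilityMeasure P] [IsProbabilityMeasure P']

/-- A random variable with finite moments of order `β` and its law: the integrability properties of
the distance to an independent copy. -/
lemma integrable_distKernel_of_moment (hβ : 0 < β) (mX : Measurable X)
    (hX : Integrable (fun ω => ‖X ω‖ ^ β) P) :
    (∀ x, Integrable (distKernel β x) (P.map X)) ∧
      Integrable (fun p : H × H => distKernel β p.1 p.2) ((P.map X).prod (P.map X)) := by
  have := Measure.isProbabilityMeasure_map (μ := P) mX.aemeasurable
  have hX' : Integrable (fun x : H => ‖x‖ ^ β) (P.map X) := by
    rwa [integrable_map_measure (measurable_norm.pow_const β).aestronglyMeasurable mX.aemeasurable]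
  exact ⟨fun x => integrable_distKernel hβ measurable_const measurable_id (integrable_const _) hX',
    integrable_distKernel hβ measurable_fst measurable_snd (hX'.comp_fst _) (hX'.comp_snd _)⟩

theorem IsIndepCopies.dcovThree (hβ : 0 < β) (hβ' : β < 2) (mX : Measurable X) (mY : Measurable Y)
    (h : IsIndepCopies P X Y P' Xs Ys) (hX : Integrable (fun ω => ‖X ω‖ ^ β) P)
    (hY : Integrable (fun ω => ‖Y ω‖ ^ β) P) :
    DcovThreeFinite β P' Xs Ys ∧ (dcovThree β P' Xs Ys = 0 ↔ IndepFun X Y P) := by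
  have := Measure.isProbabilityMeasure_map (μ := P) mX.aemeasurable
  have := Measure.isProbabilityMeasure_map (μ := P) mY.aemeasurable
  have := Measure.isProbabilityMeasure_map (μ := P) (mX.prodMk mY).aemeasurable
  have iX := h.integrable_distPow_left hβ hX
  have iY := h.integrable_distPow_right hβ hY
  have iXh : Integrable (hatVar β Xs) P' := (((iX 0 1).sub (iX 1 2)).add (iX 2 3)).sub (iX 3 0)
  have iYh : Integrable (hatVar β Ys) P' := (((iY 0 1).sub (iY 1 2)).add (iY 2 3)).sub (iY 3 0)
  obtain ⟨a1, a2⟩ := integrable_distKernel_of_moment hβ mX hX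
  obtain ⟨b1, b2⟩ := integrable_distKernel_of_moment hβ mY hY
  set μ := P.map fun ω => (X ω, Y ω) with hμ
  have fμ : μ.map Prod.fst = P.map X := Measure.fst_map_prodMk mY
  have sμ : μ.map Prod.snd = P.map Y := Measure.snd_map_prodMk mX
  set ν := P.map X
  set ρ := P.map Y
  have hl (i : Fin 4) : P'.map (fun ω => (Xs i ω, Ys i ω)) = μ := (h.identDistrib i).map_eq
  have hlX (i : Fin 4) : P'.map (Xs i) = ν := by
    rw [← fμ, ← hl i, Measure.map_map measurable_fst (h.measurable i)]; rfl
  have hlY (i : Fin 4) : P'.map (Ys i) = ρ := by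
    rw [← sμ, ← hl i, Measure.map_map measurable_snd (h.measurable i)]; rfl
  have hcX (x y : H) : distKernel β x y = distKernel β y x := distKernel_comm β x y
  have hcY (x y : K) : distKernel β x y = distKernel β y x := distKernel_comm β x y
  have tX : tildeVar β P' Xs =ᵐ[P'] fun ω => centredKernel (distKernel β) ν (Xs 0 ω) (Xs 1 ω) :=
    tildeVar_ae_eq h.measurable_left (h.indep.comp (fun _ z => z.1) fun _ => measurable_fst) hlX iXh
  have tY : tildeVar β P' Ys =ᵐ[P'] fun ω => centredKernel (distKernel β) ρ (Ys 0 ω) (Ys 1 ω) :=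
    tildeVar_ae_eq h.measurable_right (h.indep.comp (fun _ z => z.2) fun _ => measurable_snd) hlY
      iYh
  -- The majorants `f` and `g` are the mean distance powers to an independent copy.
  have key := integral_quad_mul_quad_of_degenerate h.measurable h.indep hl
    (a := fun z z' => centredKernel (distKernel β) ν z.1 z'.1)
    (b := fun z z' => centredKernel (distKernel β) ρ z.2 z'.2)
    (f := fun z => ∫ u, distKernel β z.1 u ∂ν) (g := fun z => ∫ u, distKernel β z.2 u ∂ρ)
    (measurable_centredKernel (measurable_distKernel β measurable_fst measurable_snd)
      (by fun_prop) (by fun_prop))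
    (measurable_centredKernel (measurable_distKernel β measurable_fst measurable_snd)
      (by fun_prop) (by fun_prop))
    (fun _ _ => centredKernel_comm hcX a1 a2 _ _) (fun _ _ => centredKernel_comm hcY b1 b2 _ _)
    (fun z => ?_) ?_ ?_ (fun _ => integral_nonneg fun _ => distKernel_nonneg _ _ _)
    (fun _ => integral_nonneg fun _ => distKernel_nonneg _ _ _)
    (fun _ _ => abs_centredKernel_distKernel_le hβ hβ' a1 _ _)
    (fun _ _ => abs_centredKernel_distKernel_le hβ hβ' b1 _ _)
  · have e : (fun ω => tildeVar β P' Xs ω * tildeVar β P' Ys ω) =ᵐ[P'] fun ω =>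
        centredKernel (distKernel β) ν (Xs 0 ω) (Xs 1 ω)
          * centredKernel (distKernel β) ρ (Ys 0 ω) (Ys 1 ω) := tX.mul tY
    refine ⟨⟨iXh, iYh, (integrable_congr e).2 key.1⟩, ?_⟩
    -- Centring does not change the alternating sums, so the integral for the centred kernels is
    -- that for the distances.
    have e2 : 4 * DistCov.dcovThree β P' Xs Ys = hsic (distKernel β) (distKernel β) μ := by
      rw [DistCov.dcovThree, integral_congr_ae e, ← h.integral_hatVar_mul_hatVar]
      refine key.2.symm.trans (integral_congr_ae (.of_forall fun ω => ?_))
      exact congrArg₂ (· * ·)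
        (congrFun (congrFun (congrFun (congrFun (quad_centredKernel hcX a1 a2) _) _) _) _)
        (congrFun (congrFun (congrFun (congrFun (quad_centredKernel hcY b1 b2) _) _) _) _)
    rw [← h.hsic_eq_zero_iff hβ hβ' mX mY (iX 0 1) (iY 0 1), ← e2]
    simp
  · have e : ∫ x, centredKernel (distKernel β) ν z.1 x ∂(μ.map Prod.fst) = 0 := by
      rw [fμ]; exact integral_centredKernel hcX a1 a2 z.1
    rwa [integral_map measurable_fst.aemeasurable] at e
    exact (measurable_centredKernel (measurable_distKernel β measurable_fst measurable_snd)
      measurable_const measurable_id).aestronglyMeasurable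
  · have h1 : Integrable (fun x => ∫ u, distKernel β x u ∂ν) (μ.map Prod.fst) := by
      rw [fμ]; exact a2.integral_prod_left
    exact h1.comp_measurable measurable_fst
  · have h1 : Integrable (fun y => ∫ u, distKernel β y u ∂ρ) (μ.map Prod.snd) := by
      rw [sμ]; exact b2.integral_prod_left
    exact h1.comp_measurable measurable_snd

end Copies

/-! ### Series of independent Gaussian variables -/

section Series

variable {Ω : Type*} [MeasurableSpace Ω] {P : Measure Ω} [IsProbabilityMeasure P]

/-- The extension of an independent family by zero is independent. -/
lemma iIndepFun_dite {ι : Type*} {p : ι → Prop} [DecidablePred p] {ξ : Subtype p → Ω → ℝ}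
    (h : iIndepFun ξ P) : iIndepFun (fun i ω => if hi : p i then ξ ⟨i, hi⟩ ω else 0) P := by
  rw [iIndepFun_iff_measure_inter_preimage_eq_mul]
  intro S s hs
  set f : ι → Ω → ℝ := fun i ω => if hi : p i then ξ ⟨i, hi⟩ ω else 0 with hf
  have hneg {i : ι} (hi : ¬ p i) : f i = fun _ => 0 := by funext ω; simp [hf, hi]
  have hpos (j : Subtype p) : f j = ξ j := by funext ω; simp [hf, j.2]
  -- Off `p` the variable is the constant zero: its preimages are empty or everything. An empty one
  -- makes both sides vanish; the others can be dropped.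
  by_cases hbad : ∃ k ∈ S, ¬ p k ∧ (0 : ℝ) ∉ s k
  · obtain ⟨k, hk, hpk, h0⟩ := hbad
    have he : f k ⁻¹' s k = ∅ := by rw [hneg hpk]; ext; simp [h0]
    rw [Finset.prod_eq_zero hk (by rw [he, measure_empty])]
    exact measure_mono_null (Set.iInter₂_subset k hk) (by rw [he, measure_empty])
  · push Not at hbad
    have huniv {k : ι} (hk : k ∈ S) (hpk : ¬ p k) : f k ⁻¹' s k = Set.univ := by
      rw [hneg hpk]; ext; simp [hbad k hk hpk]
    have e1 : ⋂ i ∈ S, f i ⁻¹' s i = ⋂ j ∈ S.subtype p, ξ j ⁻¹' s j := by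
      ext ω
      simp only [Set.mem_iInter, Finset.mem_subtype]
      constructor
      · intro hω j hj
        rw [← hpos]
        exact hω j hj
      · intro hω i hi
        by_cases hpi : p i
        · have := hω ⟨i, hpi⟩ hi
          rwa [← hpos] at this
        · rw [huniv hi hpi]; trivial
    rw [e1, h.measure_inter_preimage_eq_mul (S.subtype p) (sets := fun j => s j)
      (fun j hj => hs j (Finset.mem_subtype.1 hj)),
      ← Finset.prod_filter_of_ne (p := p) (s := S) (f := fun i => P (f i ⁻¹' s i)),
      ← Finset.prod_subtype_eq_prod_filter]
    · simp only [hpos]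
    · intro i hi hne
      by_contra hpi
      exact hne (by rw [huniv hi hpi, measure_univ])

variable {u : ℕ → Ω → ℝ} {v : ℕ → NNReal}

lemma map_sum_gaussianReal (hu : ∀ i, Measurable (u i)) (hi : iIndepFun u P)
    (hl : ∀ i, P.map (u i) = gaussianReal 0 (v i)) (n : ℕ) :
    P.map (∑ i ∈ Finset.range n, u i) = gaussianReal 0 (∑ i ∈ Finset.range n, v i) := by
  induction n with
  | zero => simp [Pi.zero_def, Measure.map_const, gaussianReal_zero_var]
  | succ n ih =>
    rw [Finset.sum_range_succ, Finset.sum_range_succ,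
      gaussianReal_add_gaussianReal_of_indepFun (hi.indepFun_sum_range_succ hu n) ih (hl n),
      add_zero]

lemma integrable_of_map_gaussianReal {X : Ω → ℝ} (hX : Measurable X) {w : NNReal}
    (hl : P.map X = gaussianReal 0 w) : Integrable X P := by
  have := (memLp_id_gaussianReal (μ := 0) (v := w) 1).integrable le_rfl
  rw [← hl] at this
  exact this.comp_measurable hX

lemma integral_of_map_gaussianReal {X : Ω → ℝ} (hX : Measurable X) {w : NNReal}
    (hl : P.map X = gaussianReal 0 w) : ∫ ω, X ω ∂P = 0 := by
  have := integral_id_gaussianReal (μ := 0) (v := w)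
  rwa [← hl, integral_map hX.aemeasurable (by fun_prop)] at this

lemma integral_sq_of_map_gaussianReal {X : Ω → ℝ} (hX : Measurable X) {w : NNReal}
    (hl : P.map X = gaussianReal 0 w) : Integrable (fun ω => X ω ^ 2) P ∧ ∫ ω, X ω ^ 2 ∂P = w := by
  have h2 := (memLp_id_gaussianReal (μ := 0) (v := w) 2).integrable_sq
  have := variance_id_gaussianReal (μ := 0) (v := w)
  rw [variance_eq_integral (by fun_prop)] at this
  simp only [id_eq, integral_id_gaussianReal, sub_zero] at this
  rw [← hl] at this h2
  rw [integral_map hX.aemeasurable (by fun_prop)] at this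
  exact ⟨h2.comp_measurable hX, this⟩

/-- A series of independent centred Gaussian variables with summable variances converges almost
surely. -/
lemma ae_exists_tendsto_sum_gaussian (hu : ∀ i, Measurable (u i)) (hi : iIndepFun u P)
    (hl : ∀ i, P.map (u i) = gaussianReal 0 (v i)) (hv : Summable v) :
    ∀ᵐ ω ∂P, ∃ l, Tendsto (fun n => ∑ i ∈ Finset.range n, u i ω) atTop (𝓝 l) := by
  have hus (i : ℕ) : StronglyMeasurable (u i) := (hu i).stronglyMeasurable
  set ℱ := Filtration.natural u hus
  -- The sum runs up to the index `n` inclusive, so that it is adapted to the natural filtration at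
  -- time `n`.
  set M : ℕ → Ω → ℝ := fun n => ∑ i ∈ Finset.range (n + 1), u i with hM
  have mM (n : ℕ) : Measurable (M n) := by
    rw [show M n = fun ω => ∑ i ∈ Finset.range (n + 1), u i ω from
      funext fun _ => Finset.sum_apply _ _ _]
    exact Finset.measurable_sum _ fun i _ => hu i
  have lM (n : ℕ) := map_sum_gaussianReal hu hi hl (n + 1)
  have hadp : StronglyAdapted ℱ M := fun n =>
    Finset.stronglyMeasurable_sum _ fun i hi => (Filtration.stronglyAdapted_natural hus i).mono
      (ℱ.mono (Nat.lt_succ_iff.1 (Finset.mem_range.1 hi)))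
  have hmart : Martingale M ℱ P := by
    refine martingale_of_condExp_sub_eq_zero_nat hadp
      (fun n => integrable_of_map_gaussianReal (mM n) (lM n)) fun n => ?_
    have e : M (n + 1) - M n = u (n + 1) := by
      simp only [hM]
      rw [Finset.sum_range_succ _ (n + 1), add_sub_cancel_left]
    rw [e]
    refine (hi.condExp_natural_ae_eq_of_lt hus n.lt_succ_self).trans ?_
    rw [integral_of_map_gaussianReal (hu _) (hl _)]
    rfl
  -- The variances of the partial sums are bounded by the total variance, and `|m| ≤ 1 + m²` turns
  -- this into the bound in mean required by martingale convergence.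
  have hbdd (n : ℕ) : eLpNorm (M n) 1 P ≤ ((1 + ∑' i, v i : NNReal) : ℝ≥0∞) := by
    have hi1 := integrable_of_map_gaussianReal (mM n) (lM n)
    obtain ⟨hi2, he2⟩ := integral_sq_of_map_gaussianReal (mM n) (lM n)
    rw [eLpNorm_one_eq_lintegral_enorm, ← ofReal_integral_norm_eq_lintegral_enorm hi1,
      ← ENNReal.ofReal_coe_nnreal]
    refine ENNReal.ofReal_le_ofReal ?_
    have hle : (∑ i ∈ Finset.range (n + 1), v i : NNReal) ≤ ∑' i, v i :=
      hv.sum_le_tsum _ fun _ _ => zero_le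
    calc ∫ ω, ‖M n ω‖ ∂P ≤ ∫ ω, (1 + M n ω ^ 2) ∂P := by
          refine integral_mono hi1.norm ((integrable_const _).add hi2) fun ω => ?_
          dsimp only
          rw [Real.norm_eq_abs, ← sq_abs]
          nlinarith [sq_nonneg (|M n ω| - 1), abs_nonneg (M n ω)]
      _ = 1 + ((∑ i ∈ Finset.range (n + 1), v i : NNReal) : ℝ) := by
          rw [integral_add (integrable_const _) hi2, he2]; simp
      _ ≤ ((1 + ∑' i, v i : NNReal) : ℝ) := by
          push_cast
          have := NNReal.coe_le_coe.2 hle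
          push_cast at this
          linarith
  filter_upwards [hmart.submartingale.exists_ae_tendsto_of_bdd hbdd] with ω ⟨c, hω⟩
  have h : Tendsto (fun n => ∑ i ∈ Finset.range (n + 1), u i ω) atTop
      (𝓝 c) := by
    simpa only [hM, Finset.sum_apply] using hω
  exact ⟨_, (tendsto_add_atTop_iff_nat (f := fun n => ∑ i ∈ Finset.range n, u i ω) 1).1 h⟩

/-- The characteristic functions of the partial sums at `1` converge, since the exponentials have
modulus one and are dominated by a constant. -/
lemma integral_exp_limUnder_sum_gaussian (hu : ∀ i, Measurable (u i)) (hi : iIndepFun u P)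
    (hl : ∀ i, P.map (u i) = gaussianReal 0 (v i)) {A : NNReal} (hv : HasSum v A) :
    ∫ ω, Complex.exp (Complex.I *
        (limUnder atTop (fun n => ∑ i ∈ Finset.range n, u i ω) : ℝ)) ∂P
      = Real.exp (-A / 2) := by
  have hlim : Tendsto (fun n => ∫ ω, Complex.exp (Complex.I *
      (∑ i ∈ Finset.range n, u i ω : ℝ)) ∂P) atTop (𝓝 (∫ ω, Complex.exp (Complex.I *
        (limUnder atTop (fun n => ∑ i ∈ Finset.range n, u i ω) : ℝ)) ∂P)) := by
    refine tendsto_integral_of_dominated_convergence (fun _ => 1) (fun n => ?_)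
      (integrable_const _) (fun n => .of_forall fun ω => ?_) ?_
    · exact (by fun_prop : Measurable fun ω => Complex.exp (Complex.I *
        (∑ i ∈ Finset.range n, u i ω : ℝ))).aestronglyMeasurable
    · rw [mul_comm, Complex.norm_exp_ofReal_mul_I]
    · filter_upwards [ae_exists_tendsto_sum_gaussian hu hi hl hv.summable] with ω hω
      have h := tendsto_nhds_limUnder hω
      exact (Complex.continuous_exp.tendsto _).comp
        (((Complex.continuous_ofReal.tendsto _).comp h).const_mul Complex.I)
  refine tendsto_nhds_unique hlim ?_
  have e (n : ℕ) : ∫ ω, Complex.exp (Complex.I * (∑ i ∈ Finset.range n, u i ω : ℝ)) ∂P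
      = Real.exp (-(∑ i ∈ Finset.range n, v i : NNReal) / 2) := by
    have hm : Measurable (∑ i ∈ Finset.range n, u i) := by
      rw [show ∑ i ∈ Finset.range n, u i = fun ω => ∑ i ∈ Finset.range n, u i ω from
        funext fun _ => Finset.sum_apply _ _ _]
      exact Finset.measurable_sum _ fun i _ => hu i
    have h := charFun_gaussianReal (μ := 0) (v := ∑ i ∈ Finset.range n, v i) 1
    rw [← map_sum_gaussianReal hu hi hl n, charFun_apply_real,
      integral_map hm.aemeasurable (by fun_prop)] at h
    simp only [Finset.sum_apply, Complex.ofReal_one, one_mul] at h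
    simp only [mul_comm Complex.I]
    rw [h]
    push_cast
    congr 1
    ring
  simp only [e]
  have hA : Tendsto (fun n => ((∑ i ∈ Finset.range n, v i : NNReal) : ℝ)) atTop (𝓝 A) :=
    (NNReal.continuous_coe.tendsto _).comp hv.tendsto_sum_nat
  exact (Complex.continuous_ofReal.tendsto _).comp
    ((Real.continuous_exp.tendsto _).comp ((hA.neg).div_const 2))

end Series

/-! ### The Gaussian dot product -/

section Dot

variable {N : ℕ∞} {H Ω : Type*} [NormedAddCommGroup H] [InnerProductSpace ℝ H]
  (e : HilbertBasis (Idx N) ℝ H)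

/-- The terms of the series that defines `dot`. -/
def dotTerm (t : Idx N → ℝ) (x : H) (n : ℕ) : ℝ :=
  if h : (n : ℕ∞) < N then inner ℝ x (e ⟨n, h⟩) * t ⟨n, h⟩ else 0

lemma measurable_dot [TopologicalSpace.SeparableSpace H] [MeasurableSpace H] [BorelSpace H] :
    Measurable fun q : (Idx N → ℝ) × H => dot e q.1 q.2 := by
  have : SecondCountableTopology H := UniformSpace.secondCountable_of_separable H
  refine (StronglyMeasurable.limUnder fun n => ?_).measurable
  refine (Finset.measurable_sum _ fun i _ => ?_).stronglyMeasurable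
  split_ifs with h
  · exact ((by fun_prop : Continuous fun x : H => (inner ℝ x (e ⟨i, h⟩) : ℝ)).measurable.comp
      measurable_snd).mul ((measurable_pi_apply _).comp measurable_fst)
  · exact measurable_const

variable [MeasurableSpace Ω] {P : Measure Ω} [IsProbabilityMeasure P] {ξ : Ω → Idx N → ℝ}

/-- Parseval's identity, with zero terms at the indices from `N` on. -/
lemma hasSum_dotTerm_variance (x : H) :
    HasSum (fun n : ℕ => if h : (n : ℕ∞) < N then ‖(inner ℝ x (e ⟨n, h⟩) : ℝ)‖₊ ^ 2 else 0)
      (‖x‖₊ ^ 2) := by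
  rw [← Subtype.val_injective.hasSum_iff (f := fun n : ℕ => if h : (n : ℕ∞) < N then
    ‖(inner ℝ x (e ⟨n, h⟩) : ℝ)‖₊ ^ 2 else 0) (g := (Subtype.val : Idx N → ℕ)), ← NNReal.hasSum_coe]
  · have := e.hasSum_inner_mul_inner x x
    simp only [real_inner_self_eq_norm_sq, real_inner_comm x, ← sq] at this
    have e1 (j : Idx N) : (((fun n : ℕ => if h : (n : ℕ∞) < N then
        ‖(inner ℝ x (e ⟨n, h⟩) : ℝ)‖₊ ^ 2 else 0) ∘ (Subtype.val : Idx N → ℕ)) j : ℝ)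
        = (inner ℝ x (e j) : ℝ) ^ 2 := by
      simp [j.2]
    simp only [e1]
    simpa using this
  · intro n hn
    rw [dif_neg]
    intro h
    exact hn ⟨⟨n, h⟩, rfl⟩

variable (hm : ∀ i, Measurable fun ω => ξ ω i) (hl : ∀ i, P.map (fun ω => ξ ω i) = gaussianReal 0 1)
  (hi : iIndepFun (fun i ω => ξ ω i) P)

include hm in
lemma measurable_dotTerm (x : H) (n : ℕ) : Measurable fun ω => dotTerm e (ξ ω) x n := by
  unfold dotTerm
  split_ifs with h
  · exact (hm _).const_mul _
  · exact measurable_const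

include hi in
lemma iIndepFun_dotTerm (x : H) : iIndepFun (fun n ω => dotTerm e (ξ ω) x n) P :=
  iIndepFun_dite (p := fun n : ℕ => (n : ℕ∞) < N)
    (ξ := fun j ω => inner ℝ x (e j) * ξ ω j)
    (hi.comp (fun j y => inner ℝ x (e j) * y) fun _ => measurable_const_mul _)

include hm hl in
lemma map_dotTerm (x : H) (n : ℕ) : P.map (fun ω => dotTerm e (ξ ω) x n)
    = gaussianReal 0 (if h : (n : ℕ∞) < N then ‖(inner ℝ x (e ⟨n, h⟩) : ℝ)‖₊ ^ 2 else 0) := by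
  unfold dotTerm
  split_ifs with h
  · have := (gaussianReal_const_mul (P := P) ⟨(hm ⟨n, h⟩).aemeasurable, hl ⟨n, h⟩⟩
      (inner ℝ x (e ⟨n, h⟩))).map_eq
    rw [this, mul_zero, mul_one]
    congr 1
    ext
    simp
  · simp [Measure.map_const, gaussianReal_zero_var]

include hm hl hi in
lemma ae_tendsto_dot (x : H) : ∀ᵐ ω ∂P,
    Tendsto (fun n => ∑ i ∈ Finset.range n, dotTerm e (ξ ω) x i) atTop (𝓝 (dot e (ξ ω) x)) := by
  filter_upwards [ae_exists_tendsto_sum_gaussian (measurable_dotTerm e hm x)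
    (iIndepFun_dotTerm e hi x) (map_dotTerm e hm hl x) (hasSum_dotTerm_variance e x).summable]
    with ω hω
  exact tendsto_nhds_limUnder hω

include hm hl hi in
-- Additivity of `dot` is available where all three series converge; elsewhere `limUnder` has no
-- meaning as a limit. The exceptional null set depends on `x` and `y`.
lemma ae_dot_sub (x y : H) :
    ∀ᵐ ω ∂P, dot e (ξ ω) (x - y) = dot e (ξ ω) x - dot e (ξ ω) y := by
  filter_upwards [ae_tendsto_dot e hm hl hi x, ae_tendsto_dot e hm hl hi y,
    ae_tendsto_dot e hm hl hi (x - y)] with ω h1 h2 h3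
  refine tendsto_nhds_unique h3 ((h1.sub h2).congr fun n => ?_)
  rw [← Finset.sum_sub_distrib]
  refine Finset.sum_congr rfl fun i _ => ?_
  unfold dotTerm
  split_ifs with h
  · rw [inner_sub_left]; ring
  · simp

include hm hl hi in
/-- The Gaussian kernel is the covariance kernel of the characters `exp (i ξ·x)`. -/
lemma integral_exp_dot_mul_conj (x y : H) :
    ∫ ω, Complex.exp (Complex.I * (dot e (ξ ω) x : ℂ))
      * (starRingEnd ℂ) (Complex.exp (Complex.I * (dot e (ξ ω) y : ℂ))) ∂P
      = (gaussKernel x y : ℂ) := by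
  have h := integral_exp_limUnder_sum_gaussian (measurable_dotTerm e hm (x - y))
    (iIndepFun_dotTerm e hi (x - y)) (map_dotTerm e hm hl (x - y))
    (hasSum_dotTerm_variance e (x - y))
  rw [gaussKernel]
  push_cast at h ⊢
  rw [← h]
  refine integral_congr_ae ?_
  filter_upwards [ae_dot_sub e hm hl hi x y] with ω hω
  have hd : limUnder atTop (fun n => ∑ i ∈ Finset.range n, dotTerm e (ξ ω) (x - y) i)
      = dot e (ξ ω) x - dot e (ξ ω) y := hω
  rw [hd, ← Complex.exp_conj, ← Complex.exp_add]
  congr 1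
  simp only [map_mul, Complex.conj_I, Complex.conj_ofReal]
  push_cast
  ring

end Dot

/-! ### The mean square of a covariance of characters -/

lemma measurable_comp_prodMk {α γ δ Q : Type*} [MeasurableSpace α] [MeasurableSpace γ]
    [MeasurableSpace δ] [MeasurableSpace Q] {a : α → γ → δ}
    (ma : Measurable fun q : α × γ => a q.1 q.2) {f : Q → α} {g : Q → γ} (hf : Measurable f)
    (hg : Measurable g) : Measurable fun q => a (f q) (g q) := ma.comp (hf.prodMk hg)

lemma integrable_of_norm_le_one {α : Type*} [MeasurableSpace α] {μ : Measure α} [IsFiniteMeasure μ]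
    {f : α → ℂ} (hf : Measurable f) (hb : ∀ x, ‖f x‖ ≤ 1) : Integrable f μ :=
  .of_bound hf.aestronglyMeasurable 1 (.of_forall hb)

lemma norm_mul_conj_le_one {z w : ℂ} (hz : ‖z‖ ≤ 1) (hw : ‖w‖ ≤ 1) :
    ‖z * (starRingEnd ℂ) w‖ ≤ 1 := by
  rw [norm_mul, RCLike.norm_conj]
  exact mul_le_one₀ hz (norm_nonneg _) hw

/-- The second difference of the covariance kernel of a family of bounded random variables. -/
lemma integral_sub_mul_conj_sub {Ω T E : Type*} [MeasurableSpace Ω] [MeasurableSpace T]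
    [MeasurableSpace E] {P : Measure Ω} [IsProbabilityMeasure P] {ξ : Ω → T} (hξ : Measurable ξ)
    {a : T → E → ℂ} (ma : Measurable fun q : T × E => a q.1 q.2) (ha : ∀ t x, ‖a t x‖ ≤ 1)
    {k : E → E → ℝ} (hk : ∀ x y, ∫ ω, a (ξ ω) x * (starRingEnd ℂ) (a (ξ ω) y) ∂P = k x y)
    (hk' : ∀ x y, k x y = k y x) (p q : E × E) :
    ∫ ω, (a (ξ ω) p.1 - a (ξ ω) p.2) * (starRingEnd ℂ) (a (ξ ω) q.1 - a (ξ ω) q.2) ∂P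
      = quad k p.1 q.1 p.2 q.2 := by
  have m (x : E) : Measurable fun ω => a (ξ ω) x := measurable_comp_prodMk ma hξ measurable_const
  have i (x y : E) : Integrable (fun ω => a (ξ ω) x * (starRingEnd ℂ) (a (ξ ω) y)) P :=
    integrable_of_norm_le_one ((m x).mul ((Complex.continuous_conj.measurable).comp (m y)))
      fun ω => norm_mul_conj_le_one (ha _ _) (ha _ _)
  have e : (fun ω => (a (ξ ω) p.1 - a (ξ ω) p.2) * (starRingEnd ℂ) (a (ξ ω) q.1 - a (ξ ω) q.2))
      = fun ω => a (ξ ω) p.1 * (starRingEnd ℂ) (a (ξ ω) q.1)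
        - a (ξ ω) p.2 * (starRingEnd ℂ) (a (ξ ω) q.1) + a (ξ ω) p.2 * (starRingEnd ℂ) (a (ξ ω) q.2)
        - a (ξ ω) p.1 * (starRingEnd ℂ) (a (ξ ω) q.2) := by
    funext ω
    rw [map_sub]
    ring
  rw [e]
  refine ((integral_sub (((i _ _).sub (i _ _)).add (i _ _)) (i _ _)).trans (congrArg₂ _
    ((integral_add ((i _ _).sub (i _ _)) (i _ _)).trans (congrArg₂ _
      (integral_sub (i _ _) (i _ _)) rfl)) rfl)).trans ?_
  simp only [hk, quad, hk' q.1 p.2, hk' q.2 p.1]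
  push_cast
  ring

/-- For fixed characters, twice the covariance is the mean of `A * B` over a pair of independent
points, so four times its squared modulus is a mean over two such pairs. After exchanging the
integrals, independence of `ξ` and `η` factors the expectation into the two alternating sums. -/
lemma lintegral_sq_covariance {Ω T S E : Type*} [MeasurableSpace Ω] [MeasurableSpace T]
    [MeasurableSpace S] [MeasurableSpace E] {P : Measure Ω} [IsProbabilityMeasure P]
    {μ : Measure E} [IsProbabilityMeasure μ] {ξ : Ω → T} {η : Ω → S} (hξ : Measurable ξ)
    (hη : Measurable η) (hi : IndepFun ξ η P) {a : T → E → ℂ} {b : S → E → ℂ}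
    (ma : Measurable fun q : T × E => a q.1 q.2) (mb : Measurable fun q : S × E => b q.1 q.2)
    (ha : ∀ t x, ‖a t x‖ ≤ 1) (hb : ∀ s x, ‖b s x‖ ≤ 1) {k l : E → E → ℝ}
    (hk : ∀ x y, ∫ ω, a (ξ ω) x * (starRingEnd ℂ) (a (ξ ω) y) ∂P = k x y)
    (hl : ∀ x y, ∫ ω, b (η ω) x * (starRingEnd ℂ) (b (η ω) y) ∂P = l x y)
    (hk' : ∀ x y, k x y = k y x) (hl' : ∀ x y, l x y = l y x) :
    ∫⁻ ω, ‖(∫ x, a (ξ ω) x * b (η ω) x ∂μ)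
        - (∫ x, a (ξ ω) x ∂μ) * ∫ x, b (η ω) x ∂μ‖ₑ ^ 2 ∂P
      = ENNReal.ofReal ((∫ z, quad k z.1.1 z.2.1 z.1.2 z.2.2 * quad l z.1.1 z.2.1 z.1.2 z.2.2
        ∂((μ.prod μ).prod (μ.prod μ))) / 4) := by
  set A : T → E × E → ℂ := fun t p => a t p.1 - a t p.2 with hA
  set B : S → E × E → ℂ := fun s p => b s p.1 - b s p.2 with hB
  set D : Ω → ℂ := fun ω => (∫ x, a (ξ ω) x * b (η ω) x ∂μ)
    - (∫ x, a (ξ ω) x ∂μ) * ∫ x, b (η ω) x ∂μ with hD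
  have mA : Measurable fun q : T × (E × E) => A q.1 q.2 :=
    (measurable_comp_prodMk ma (by fun_prop) (by fun_prop)).sub
      (measurable_comp_prodMk ma (by fun_prop) (by fun_prop))
  have mB : Measurable fun q : S × (E × E) => B q.1 q.2 :=
    (measurable_comp_prodMk mb (by fun_prop) (by fun_prop)).sub
      (measurable_comp_prodMk mb (by fun_prop) (by fun_prop))
  have nA (t p) : ‖A t p‖ ≤ 2 := (norm_sub_le _ _).trans (by linarith [ha t p.1, ha t p.2])
  have nB (s p) : ‖B s p‖ ≤ 2 := (norm_sub_le _ _).trans (by linarith [hb s p.1, hb s p.2])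
  have mconj := Complex.continuous_conj.measurable
  have mF : Measurable fun q : Ω × ((E × E) × (E × E)) => (A (ξ q.1) q.2.1 * B (η q.1) q.2.1)
      * (starRingEnd ℂ) (A (ξ q.1) q.2.2 * B (η q.1) q.2.2) :=
    ((measurable_comp_prodMk mA (by fun_prop) (by fun_prop)).mul
      (measurable_comp_prodMk mB (by fun_prop) (by fun_prop))).mul (mconj.comp
      ((measurable_comp_prodMk mA (by fun_prop) (by fun_prop)).mul
      (measurable_comp_prodMk mB (by fun_prop) (by fun_prop))))
  have iF : Integrable (fun q : Ω × ((E × E) × (E × E)) => (A (ξ q.1) q.2.1 * B (η q.1) q.2.1)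
      * (starRingEnd ℂ) (A (ξ q.1) q.2.2 * B (η q.1) q.2.2))
      (P.prod ((μ.prod μ).prod (μ.prod μ))) := by
    refine .of_bound mF.aestronglyMeasurable (2 * 2 * (2 * 2)) (.of_forall fun q => ?_)
    rw [norm_mul, RCLike.norm_conj, norm_mul, norm_mul]
    exact mul_le_mul (mul_le_mul (nA _ _) (nB _ _) (norm_nonneg _) zero_le_two)
      (mul_le_mul (nA _ _) (nB _ _) (norm_nonneg _) zero_le_two) (by positivity) (by norm_num)
  -- the inner integral for fixed characters
  have e1 (ω : Ω) : ∫ z : (E × E) × (E × E), (A (ξ ω) z.1 * B (η ω) z.1)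
      * (starRingEnd ℂ) (A (ξ ω) z.2 * B (η ω) z.2) ∂(μ.prod μ).prod (μ.prod μ)
      = ((4 * ‖D ω‖ ^ 2 : ℝ) : ℂ) := by
    have m1 : Measurable (a (ξ ω)) := measurable_comp_prodMk ma measurable_const measurable_id
    have m2 : Measurable (b (η ω)) := measurable_comp_prodMk mb measurable_const measurable_id
    have h := integral_sub_mul_sub μ (integrable_of_norm_le_one m1 (ha _))
      (integrable_of_norm_le_one m2 (hb _)) (integrable_of_norm_le_one (m1.mul m2) fun x => by
        rw [norm_mul]; exact mul_le_one₀ (ha _ _) (norm_nonneg _) (hb _ _))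
    rw [integral_prod_mul (fun p => A (ξ ω) p * B (η ω) p)
      (fun p => (starRingEnd ℂ) (A (ξ ω) p * B (η ω) p)), integral_conj]
    have h' : ∫ p, A (ξ ω) p * B (η ω) p ∂μ.prod μ = 2 * D ω := h
    rw [h', Complex.mul_conj, Complex.normSq_eq_norm_sq, norm_mul, mul_pow]
    norm_num
  -- the inner integral for fixed points
  have e2 (z : (E × E) × (E × E)) : ∫ ω, (A (ξ ω) z.1 * B (η ω) z.1)
      * (starRingEnd ℂ) (A (ξ ω) z.2 * B (η ω) z.2) ∂P
      = ((quad k z.1.1 z.2.1 z.1.2 z.2.2 * quad l z.1.1 z.2.1 z.1.2 z.2.2 : ℝ) : ℂ) := by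
    have mA' (p : E × E) : Measurable fun t => A t p :=
      measurable_comp_prodMk mA measurable_id measurable_const
    have mB' (p : E × E) : Measurable fun s => B s p :=
      measurable_comp_prodMk mB measurable_id measurable_const
    have m1 : Measurable fun t => A t z.1 * (starRingEnd ℂ) (A t z.2) :=
      (mA' _).mul (mconj.comp (mA' _))
    have m2 : Measurable fun s => B s z.1 * (starRingEnd ℂ) (B s z.2) :=
      (mB' _).mul (mconj.comp (mB' _))
    have h := (hi.comp m1 m2).integral_fun_mul_eq_mul_integral
      (m1.comp hξ).aestronglyMeasurable (m2.comp hη).aestronglyMeasurable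
    simp only [Function.comp_apply] at h
    rw [integral_sub_mul_conj_sub hξ ma ha hk hk' z.1 z.2,
      integral_sub_mul_conj_sub hη mb hb hl hl' z.1 z.2, ← Complex.ofReal_mul] at h
    rw [← h]
    refine integral_congr_ae (.of_forall fun ω => ?_)
    simp only [map_mul]
    ring
  have i4 : Integrable (fun ω => 4 * ‖D ω‖ ^ 2) P := by
    have := iF.integral_prod_left
    simp only [e1] at this
    exact this.re
  have key : ∫ ω, 4 * ‖D ω‖ ^ 2 ∂P = ∫ z, quad k z.1.1 z.2.1 z.1.2 z.2.2
      * quad l z.1.1 z.2.1 z.1.2 z.2.2 ∂((μ.prod μ).prod (μ.prod μ)) := by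
    have := integral_integral_swap (f := fun ω (z : (E × E) × (E × E)) =>
      (A (ξ ω) z.1 * B (η ω) z.1) * (starRingEnd ℂ) (A (ξ ω) z.2 * B (η ω) z.2)) iF
    simp only [e1, e2] at this
    rw [integral_complex_ofReal, integral_complex_ofReal] at this
    exact Complex.ofReal_injective this
  have iD : Integrable (fun ω => ‖D ω‖ ^ 2) P := by
    simpa using i4.const_mul (1 / 4)
  rw [← key, integral_const_mul, mul_div_cancel_left₀ _ (by norm_num),
    ofReal_integral_eq_lintegral_ofReal iD (.of_forall fun ω => sq_nonneg _)]
  refine lintegral_congr fun ω => ?_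
  rw [ENNReal.ofReal_pow (norm_nonneg _), ofReal_norm]

/-! ### The definition by means of characteristic random variables -/

/-- The argument `-β / 2` lies strictly between the consecutive poles `-1` and `0` of the Gamma
function. -/
lemma gaussConst_ne_zero {β : ℝ} (hβ : 0 < β) (hβ' : β < 2) : gaussConst β ≠ 0 := by
  refine div_ne_zero (Real.rpow_pos_of_pos two_pos _).ne' (neg_ne_zero.2 (Real.Gamma_ne_zero ?_))
  intro m hm
  rcases m with _ | m
  · simp at hm
    linarith
  · push_cast at hm
    have : (0 : ℝ) ≤ m := m.cast_nonneg
    linarith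

/-- The coordinates are swapped because the outer integral in `dcovGauss` runs over the scale of the
second variable. -/
lemma measurable_hsic_scaledKernel {H K : Type*}
    [NormedAddCommGroup H] [NormedSpace ℝ H] [TopologicalSpace.SeparableSpace H]
    [MeasurableSpace H] [BorelSpace H]
    [NormedAddCommGroup K] [NormedSpace ℝ K] [TopologicalSpace.SeparableSpace K]
    [MeasurableSpace K] [BorelSpace K] (μ : Measure (H × K)) [IsProbabilityMeasure μ] :
    Measurable fun q : ℝ × ℝ => hsic (scaledKernel (H := H) q.2) (scaledKernel (H := K) q.1) μ := by
  have h : Measurable fun q : (ℝ × ℝ) × (((H × K) × (H × K)) × ((H × K) × (H × K))) =>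
      quad (scaledKernel q.1.2) q.2.1.1.1 q.2.2.1.1 q.2.1.2.1 q.2.2.2.1
        * quad (scaledKernel q.1.1) q.2.1.1.2 q.2.2.1.2 q.2.1.2.2 q.2.2.2.2 :=
    (measurable_quad_scaledKernel (by fun_prop) (by fun_prop) (by fun_prop) (by fun_prop)
      (by fun_prop)).mul (measurable_quad_scaledKernel (by fun_prop) (by fun_prop) (by fun_prop)
      (by fun_prop) (by fun_prop))
  exact h.stronglyMeasurable.integral_prod_right'.measurable

lemma indepFun_pi_of_iIndepFun_sum {ι κ Ω : Type*} [MeasurableSpace Ω] {P : Measure Ω}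
    {ξ : Ω → ι → ℝ} {η : Ω → κ → ℝ} (hξ : ∀ i, Measurable fun ω => ξ ω i)
    (hη : ∀ j, Measurable fun ω => η ω j)
    (h : iIndepFun (fun (k : ι ⊕ κ) ω => Sum.elim (ξ ω) (η ω) k) P) : IndepFun ξ η P := by
  have hle (k : ι ⊕ κ) : MeasurableSpace.comap (fun ω => Sum.elim (ξ ω) (η ω) k) inferInstance
      ≤ (inferInstance : MeasurableSpace Ω) := by
    rcases k with i | j
    · exact (hξ i).comap_le
    · exact (hη j).comap_le
  have := indep_iSup_of_disjoint hle h (S := Set.range Sum.inl) (T := Set.range Sum.inr)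
    Set.isCompl_range_inl_range_inr.disjoint
  rw [iSup_range, iSup_range] at this
  rw [IndepFun_iff_Indep]
  simpa only [MeasurableSpace.pi, MeasurableSpace.comap_iSup, MeasurableSpace.comap_comp,
    Function.comp_def, Sum.elim_inl, Sum.elim_inr] using this

section Gauss

variable {N M : ℕ∞} {H K Ω : Type*}
    [NormedAddCommGroup H] [InnerProductSpace ℝ H] [CompleteSpace H]
    [TopologicalSpace.SeparableSpace H] [MeasurableSpace H] [BorelSpace H]
    [NormedAddCommGroup K] [InnerProductSpace ℝ K] [CompleteSpace K]
    [TopologicalSpace.SeparableSpace K] [MeasurableSpace K] [BorelSpace K]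
    [MeasurableSpace Ω] {P : Measure Ω} [IsProbabilityMeasure P]
    (e : HilbertBasis (Idx N) ℝ H) (f : HilbertBasis (Idx M) ℝ K)
    {ξ : Ω → Idx N → ℝ} {η : Ω → Idx M → ℝ} {X : Ω → H} {Y : Ω → K}

/-- The character `exp (i r t·x)`. -/
def character (r : ℝ) (t : Idx N → ℝ) (x : H) : ℂ :=
  Complex.exp (Complex.I * (dot e t (r • x) : ℂ))

lemma measurable_character (r : ℝ) :
    Measurable fun q : (Idx N → ℝ) × H => character e r q.1 q.2 := by
  have h : Measurable fun q : (Idx N → ℝ) × H => dot e q.1 (r • q.2) :=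
    measurable_comp_prodMk (measurable_dot e) measurable_fst (measurable_snd.const_smul r)
  unfold character
  fun_prop

lemma norm_character_le (r : ℝ) (t : Idx N → ℝ) (x : H) : ‖character e r t x‖ ≤ 1 := by
  rw [character, mul_comm, Complex.norm_exp_ofReal_mul_I]

/-- By independence, conditioning freezes the Gaussian variables and integrates over the law of `(X,
Y)`. The expression becomes the mean squared covariance of random characters whose covariance
kernels are the scaled Gaussian kernels. -/
lemma lintegral_charVar (hX : Measurable X) (hY : Measurable Y) (h : IsGaussianAux P X Y ξ η)
    (r s : ℝ) :
    ∫⁻ ω, ‖jointCharVar P e f ξ η (fun ω' => r • X ω') (fun ω' => s • Y ω') ω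
        - charVar P e ξ (fun ω' => r • X ω') ω * charVar P f η (fun ω' => s • Y ω') ω‖ₑ ^ 2 ∂P
      = ENNReal.ofReal
        (hsic (scaledKernel r) (scaledKernel s) (P.map fun ω => (X ω, Y ω)) / 4) := by
  have : SecondCountableTopology H := UniformSpace.secondCountable_of_separable H
  have : SecondCountableTopology K := UniformSpace.secondCountable_of_separable K
  have mXY := hX.prodMk hY
  have := Measure.isProbabilityMeasure_map (μ := P) mXY.aemeasurable
  set μ := P.map fun ω => (X ω, Y ω)
  have mξ : Measurable ξ := measurable_pi_lambda _ h.measurable_left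
  have mη : Measurable η := measurable_pi_lambda _ h.measurable_right
  have ma : Measurable fun q : (Idx N → ℝ) × (H × K) => character e r q.1 q.2.1 :=
    measurable_comp_prodMk (measurable_character e r) measurable_fst
      (measurable_fst.comp measurable_snd)
  have mb : Measurable fun q : (Idx M → ℝ) × (H × K) => character f s q.1 q.2.2 :=
    measurable_comp_prodMk (measurable_character f s) measurable_fst
      (measurable_snd.comp measurable_snd)
  have c1 : charVar P e ξ (fun ω' => r • X ω')
      =ᵐ[P] fun ω => ∫ z : H × K, character e r (ξ ω) z.1 ∂μ :=
    condExp_prod_of_indepFun mξ mXY (h.indep_pair.comp measurable_fst measurable_id)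
      ma.stronglyMeasurable (integrable_of_norm_le_one (ma.comp (mξ.prodMk mXY))
        fun ω => norm_character_le e r _ _)
  have c2 : charVar P f η (fun ω' => s • Y ω')
      =ᵐ[P] fun ω => ∫ z : H × K, character f s (η ω) z.2 ∂μ :=
    condExp_prod_of_indepFun mη mXY (h.indep_pair.comp measurable_snd measurable_id)
      mb.stronglyMeasurable (integrable_of_norm_le_one (mb.comp (mη.prodMk mXY))
        fun ω => norm_character_le f s _ _)
  have mab : Measurable fun q : ((Idx N → ℝ) × (Idx M → ℝ)) × (H × K) =>
      character e r q.1.1 q.2.1 * character f s q.1.2 q.2.2 :=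
    (measurable_comp_prodMk (measurable_character e r) (by fun_prop) (by fun_prop)).mul
      (measurable_comp_prodMk (measurable_character f s) (by fun_prop) (by fun_prop))
  have c3 : jointCharVar P e f ξ η (fun ω' => r • X ω') (fun ω' => s • Y ω')
      =ᵐ[P] fun ω => ∫ z : H × K, character e r (ξ ω) z.1 * character f s (η ω) z.2 ∂μ := by
    have := condExp_prod_of_indepFun (mξ.prodMk mη) mXY h.indep_pair mab.stronglyMeasurable
      (integrable_of_norm_le_one (mab.comp ((mξ.prodMk mη).prodMk mXY)) fun ω => by
        rw [norm_mul]
        exact mul_le_one₀ (norm_character_le e r _ _) (norm_nonneg _) (norm_character_le f s _ _))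
    refine EventuallyEq.trans (EventuallyEq.of_eq ?_) this
    unfold jointCharVar
    congr 1
    funext ω
    exact Complex.exp_add _ _
  have iξ : iIndepFun (fun i ω => ξ ω i) P :=
    h.indep.precomp (g := Sum.inl) Sum.inl_injective
  have iη : iIndepFun (fun j ω => η ω j) P :=
    h.indep.precomp (g := Sum.inr) Sum.inr_injective
  have key := lintegral_sq_covariance (μ := μ) mξ mη
    (indepFun_pi_of_iIndepFun_sum h.measurable_left h.measurable_right h.indep)
    (a := fun t z => character e r t z.1) (b := fun t z => character f s t z.2)
    (k := fun z z' => scaledKernel r z.1 z'.1) (l := fun z z' => scaledKernel s z.2 z'.2) ma mb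
    (fun _ _ => norm_character_le e r _ _) (fun _ _ => norm_character_le f s _ _)
    (fun z z' => by
      rw [scaledKernel]
      exact integral_exp_dot_mul_conj e h.measurable_left h.law_left iξ (r • z.1) (r • z'.1))
    (fun z z' => by
      rw [scaledKernel]
      exact integral_exp_dot_mul_conj f h.measurable_right h.law_right iη (s • z.2) (s • z'.2))
    (fun _ _ => scaledKernel_comm _ _ _) (fun _ _ => scaledKernel_comm _ _ _)
  refine (lintegral_congr_ae ?_).trans key
  filter_upwards [c1, c2, c3] with ω h1 h2 h3
  rw [h1, h2, h3]

/-- A vanishing integral of a nonnegative function provides a pair of positive scales at which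
`hsic` vanishes; the converse is immediate, since under independence `hsic` is zero at all scales.
-/
theorem dcovGauss_eq_zero_iff {β : ℝ} (hβ : 0 < β) (hβ' : β < 2) (hX : Measurable X)
    (hY : Measurable Y) (h : IsGaussianAux P X Y ξ η) :
    dcovGauss β P e f ξ η X Y = 0 ↔ IndepFun X Y P := by
  have := Measure.isProbabilityMeasure_map (μ := P) (hX.prodMk hY).aemeasurable
  rw [indepFun_iff_map_eq_prod_fst_snd hX hY]
  have hc : ENNReal.ofReal (gaussConst β ^ 2) ≠ 0 := by
    rw [Ne, ENNReal.ofReal_eq_zero, not_le]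
    exact pow_pos (sq_pos_of_ne_zero (gaussConst_ne_zero hβ hβ')) 1 |>.trans_eq (pow_one _)
  simp only [dcovGauss, lintegral_charVar e f hX hY h, mul_eq_zero, hc, false_or]
  set μ := P.map fun ω => (X ω, Y ω)
  constructor
  · intro h0
    have hm : Measurable fun q : ℝ × ℝ =>
        ENNReal.ofReal (hsic (scaledKernel (H := H) q.2) (scaledKernel (H := K) q.1) μ / 4)
          * ENNReal.ofReal (1 / (q.2 ^ (β + 1) * q.1 ^ (β + 1))) :=
      ((measurable_hsic_scaledKernel μ).div_const 4).ennreal_ofReal.mul (by fun_prop)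
    rw [lintegral_eq_zero_iff hm.lintegral_prod_right'] at h0
    have hne : (ae ((volume : Measure ℝ).restrict (Set.Ioi 0))).NeBot := by
      rw [ae_neBot, Ne, Measure.restrict_eq_zero]
      simp
    obtain ⟨s, hs0, hs⟩ := (h0.and (ae_restrict_mem measurableSet_Ioi)).exists
    simp only [Pi.zero_apply] at hs0
    have hm' : Measurable fun r : ℝ =>
        ENNReal.ofReal (hsic (scaledKernel (H := H) r) (scaledKernel (H := K) s) μ / 4)
          * ENNReal.ofReal (1 / (r ^ (β + 1) * s ^ (β + 1))) := by
      simpa only [Function.comp_def] using hm.comp (measurable_prodMk_left (x := s))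
    rw [lintegral_eq_zero_iff hm'] at hs0
    obtain ⟨r, hr0, hr⟩ := (hs0.and (ae_restrict_mem measurableSet_Ioi)).exists
    have hs : 0 < s := hs
    have hr : 0 < r := hr
    have hpos : 0 < 1 / (r ^ (β + 1) * s ^ (β + 1)) :=
      one_div_pos.2 (mul_pos (Real.rpow_pos_of_pos hr _) (Real.rpow_pos_of_pos hs _))
    simp only [Pi.zero_apply, mul_eq_zero, ENNReal.ofReal_eq_zero,
      not_le.2 hpos, or_false] at hr0
    refine eq_prod_of_hsic_scaledKernel_eq_zero hr.ne' hs.ne' μ (le_antisymm ?_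
      (hsic_scaledKernel_nonneg r s μ))
    linarith
  · intro hμ
    have h0 (r s : ℝ) : hsic (scaledKernel (H := H) r) (scaledKernel (H := K) s) μ = 0 := by
      have := hsic_scaledKernel_prod r s μ.fst μ.snd
      rwa [← hμ] at this
    simp [h0]

end Gauss

end DistCov

end

theorem mainTheorem1
    {H K Ω Ω₁ Ω₂ : Type*}
    [NormedAddCommGroup H] [InnerProductSpace ℝ H] [CompleteSpace H]
    [TopologicalSpace.SeparableSpace H] [MeasurableSpace H] [BorelSpace H]
    [NormedAddCommGroup K] [InnerProductSpace ℝ K] [CompleteSpace K]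
    [TopologicalSpace.SeparableSpace K] [MeasurableSpace K] [BorelSpace K]
    [MeasurableSpace Ω] (P : Measure Ω) [IsProbabilityMeasure P]
    [MeasurableSpace Ω₁] (P₁ : Measure Ω₁) [IsProbabilityMeasure P₁]
    [MeasurableSpace Ω₂] (P₂ : Measure Ω₂) [IsProbabilityMeasure P₂]
    (β : ℝ) (hβ : 0 < β) (hβ' : β < 2)
    (X : Ω → H) (Y : Ω → K) (hX : Measurable X) (hY : Measurable Y) :
    (∀ (Xs : Fin 4 → Ω₁ → H) (Ys : Fin 4 → Ω₁ → K), DistCov.IsIndepCopies P X Y P₁ Xs Ys →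
      (Integrable (fun ω => ‖X ω‖ ^ (2 * β)) P → Integrable (fun ω => ‖Y ω‖ ^ (2 * β)) P →
        DistCov.DcovOneFinite β P₁ Xs Ys ∧
          (DistCov.dcovOne β P₁ Xs Ys = 0 ↔ IndepFun X Y P)) ∧
      (Integrable (fun ω => ‖X ω‖ ^ β) P → Integrable (fun ω => ‖Y ω‖ ^ β) P →
        DistCov.DcovTwoFinite β P₁ Xs Ys ∧
          (DistCov.dcovTwo β P₁ Xs Ys = 0 ↔ IndepFun X Y P)) ∧
      (Integrable (fun ω => ‖X ω‖ ^ β) P → Integrable (fun ω => ‖Y ω‖ ^ β) P →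
        DistCov.DcovThreeFinite β P₁ Xs Ys ∧
          (DistCov.dcovThree β P₁ Xs Ys = 0 ↔ IndepFun X Y P))) ∧
    (∀ (N M : ℕ∞) (e : HilbertBasis (DistCov.Idx N) ℝ H) (f : HilbertBasis (DistCov.Idx M) ℝ K)
      (X' : Ω₂ → H) (Y' : Ω₂ → K) (ξ : Ω₂ → DistCov.Idx N → ℝ) (η : Ω₂ → DistCov.Idx M → ℝ),
      Measurable X' → Measurable Y' →
      IdentDistrib (fun ω => (X' ω, Y' ω)) (fun ω => (X ω, Y ω)) P₂ P →
      DistCov.IsGaussianAux P₂ X' Y' ξ η →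
        (DistCov.dcovGauss β P₂ e f ξ η X' Y' = 0 ↔ IndepFun X Y P)) := by
  refine ⟨fun Xs Ys h => ⟨fun iX iY => h.dcovOne hβ hβ' hX hY iX iY,
    fun iX iY => h.dcovTwo hβ hβ' hX hY iX iY, fun iX iY => h.dcovThree hβ hβ' hX hY iX iY⟩,
    fun N M e f X' Y' ξ η hX' hY' hid h => ?_⟩
  -- Independence depends only on the joint law, so it passes from the copy `(X', Y')`, defined
  -- together with the Gaussian variables, to `(X, Y)`.
  rw [DistCov.dcovGauss_eq_zero_iff e f hβ hβ' hX' hY' h,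
    DistCov.indepFun_iff_map_eq_prod_fst_snd hX' hY', hid.map_eq,
    ← DistCov.indepFun_iff_map_eq_prod_fst_snd hX hY]
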